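/- Let $m$ be Lebesgue measure on $[0,1]$, and let $\psi:[0,1]\to[0,\infty)$ be a non-decreasing continuous concave function with $\psi(0)=0$ which is not identically zero. For a measurable function $x:[0,1]\to\mathbb{R}$ let $x^*(t)=\inf\{s\ge 0: m\{u\in[0,1]:|x(u)|>s\}\le t\}$, $t>0$, be its decreasing rearrangement. Let $\Lambda(\psi)$ be the Lorentz space of all (classes of a.e. equal) measurable functions $x$ on $[0,1]$ with $$\|x\|_{\Lambda(\psi)}=\int_0^1 x^*(t)\,d\psi(t)<\infty .$$ For $p\ge 1$, a bounded sequence $(x_n)$ in a normed space $E$ is called a $p$-BS-sequence if every subsequence $(y_k)$ of $(x_n)$ satisfies $\sup_{N\ge 1} N^{-1/p}\big\|\sum_{k=1}^N y_k\big\|_E<\infty$. Let $\Gamma_{\rm iid}(\Lambda(\psi))$ be the set of all real $p\ge 1$ such that every weakly null sequence in $\Lambda(\psi)$ which consists of independent identically distributed random variables on the probability space $([0,1],m)$ contains a subsequence that is a $p$-BS-sequence. **Theorem.** $\Gamma_{\rm iid}(\Lambda(\psi))\neq\{1\}$ if and only if there exist integers $k\ge 2$ and $l\ge 2$ such that $$\limsup_{u\to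 0+}\frac{\psi(ku)}{\psi(u)}<k\qquad\text{and}\qquad \limsup_{u\to 0+}\frac{\psi(u^l)}{\psi(u)}<1 .$$ -/

import Mathlib

open MeasureTheory Set Filter Topology ProbabilityTheory
open scoped unitInterval ENNReal

namespace LorentzBS

/-- The class `Ψ`: (not identically zero) increasing continuous concave functions `ψ` on `[0,1]`
with `ψ 0 = 0`. Only the values on `[0,1]` matter. "Increasing" is understood in the
non-strict sense. -/
structure LorentzWeight where
  toFun : ℝ → ℝ
  monotoneOn : MonotoneOn toFun (Icc 0 1)
  continuousOn : ContinuousOn toFun (Icc 0 1)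
  concaveOn : ConcaveOn ℝ (Icc 0 1) toFun
  map_zero : toFun 0 = 0
  nontrivial : ∃ t ∈ Icc (0 : ℝ) 1, toFun t ≠ 0

instance : CoeFun LorentzWeight (fun _ => ℝ → ℝ) := ⟨LorentzWeight.toFun⟩

/-- The distribution function `s ↦ m {u ∈ [0,1] : |x u| > s}`. -/
noncomputable def distr (x : I → ℝ) (s : ℝ) : ℝ := volume.real {u : I | s < |x u|}

/-- The decreasing rearrangement `x*(t) = inf {s ≥ 0 : m {u : |x u| > s} ≤ t}`, used for `t > 0`. -/
noncomputable def rearr (x : I → ℝ) (t : ℝ) : ℝ := sInf {s : ℝ | 0 ≤ s ∧ distr x s ≤ t}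

/-- `ψ` extended to the line by constants, as a function defining a Stieltjes measure `dψ`. -/
noncomputable def LorentzWeight.stieltjes (ψ : LorentzWeight) : StieltjesFunction ℝ where
  toFun := IccExtend zero_le_one (fun t : Icc (0 : ℝ) 1 => ψ t)
  mono' := by
    apply Monotone.IccExtend
    intro a b hab
    exact ψ.monotoneOn a.2 b.2 hab
  right_continuous' := by
    intro x
    apply Continuous.continuousWithinAt
    exact (continuousOn_iff_continuous_domRestrict.1 ψ.continuousOn).Icc_extend'

/-- The Lorentz functional `∫₀¹ x*(t) dψ(t)`, with values in `[0,∞]`. -/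
noncomputable def lorentzENorm (ψ : LorentzWeight) (x : I → ℝ) : ℝ≥0∞ :=
  ∫⁻ t in Ioc 0 1, ENNReal.ofReal (rearr x t) ∂ψ.stieltjes.measure

/-! ### The Lorentz functional is a norm -/

section Aux

variable (ψ : LorentzWeight) {x y : I → ℝ}

lemma stieltjes_eq {t : ℝ} (h0 : 0 ≤ t) (h1 : t ≤ 1) : ψ.stieltjes t = ψ t :=
  IccExtend_of_mem zero_le_one (fun t : Icc (0 : ℝ) 1 => ψ t) ⟨h0, h1⟩

lemma stieltjes_continuous : Continuous ψ.stieltjes :=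
  (continuousOn_iff_continuous_domRestrict.1 ψ.continuousOn).Icc_extend'

lemma leftLim_stieltjes (t : ℝ) : Function.leftLim ψ.stieltjes t = ψ.stieltjes t :=
  (ψ.stieltjes.mono.continuousWithinAt_Iio_iff_leftLim_eq).1
    (stieltjes_continuous ψ).continuousWithinAt

lemma LorentzWeight.nonneg {t : ℝ} (h0 : 0 ≤ t) (h1 : t ≤ 1) : 0 ≤ ψ t := by
  have := ψ.monotoneOn (left_mem_Icc.2 zero_le_one) ⟨h0, h1⟩ h0
  rwa [ψ.map_zero] at this

lemma LorentzWeight.pos {t : ℝ} (h0 : 0 < t) (h1 : t ≤ 1) : 0 < ψ t := by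
  obtain ⟨r, hr, hr0⟩ := ψ.nontrivial
  have hone : 0 < ψ 1 := by
    have h := ψ.monotoneOn hr (right_mem_Icc.2 zero_le_one) hr.2
    exact lt_of_lt_of_le (lt_of_le_of_ne (ψ.nonneg hr.1 hr.2) (Ne.symm hr0)) h
  have h := ψ.concaveOn.2 (right_mem_Icc.2 zero_le_one) (left_mem_Icc.2 zero_le_one)
    h0.le (sub_nonneg.2 h1) (by ring)
  simp only [smul_eq_mul, mul_one, mul_zero, add_zero, ψ.map_zero] at h
  exact lt_of_lt_of_le (mul_pos h0 hone) h

lemma distr_nonneg (s : ℝ) : 0 ≤ distr x s := measureReal_nonneg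

lemma distr_le_one (s : ℝ) : distr x s ≤ 1 := measureReal_le_one

lemma distr_antitone : Antitone (distr x) := by
  intro s t hst
  exact measureReal_mono (fun u (hu : t < |x u|) => lt_of_le_of_lt hst hu)

lemma ofReal_distr (s : ℝ) : ENNReal.ofReal (distr x s) = volume {u : I | s < |x u|} :=
  ofReal_measureReal

lemma distr_congr (h : x =ᵐ[volume] y) : distr x = distr y := by
  funext s
  apply measureReal_congr
  filter_upwards [h] with u hu
  change (s < |x u|) = (s < |y u|)
  rw [hu]

/-- The distribution function is right-continuous. -/
lemma exists_lt_distr {s t : ℝ} (h : t < distr x s) : ∃ s' > s, t < distr x s' := by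
  have hU : {u : I | s < |x u|} = ⋃ n : ℕ, {u : I | s + 1 / ((n : ℝ) + 1) < |x u|} := by
    ext u
    simp only [mem_ofPred_eq, mem_iUnion]
    constructor
    · intro hu
      obtain ⟨n, hn⟩ := exists_nat_one_div_lt (sub_pos.2 hu)
      exact ⟨n, by linarith⟩
    · rintro ⟨n, hn⟩
      have : (0 : ℝ) < 1 / ((n : ℝ) + 1) := by positivity
      linarith
  have hmono : Monotone (fun n : ℕ => {u : I | s + 1 / ((n : ℝ) + 1) < |x u|}) := by
    intro m n hmn u hu
    have : 1 / ((n : ℝ) + 1) ≤ 1 / ((m : ℝ) + 1) := Nat.one_div_le_one_div hmn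
    simp only [mem_ofPred_eq] at hu ⊢
    linarith
  have ht := tendsto_measure_iUnion_atTop (μ := (volume : Measure I)) hmono
  rw [← hU] at ht
  have ht' : Tendsto (fun n : ℕ => distr x (s + 1 / ((n : ℝ) + 1))) atTop (𝓝 (distr x s)) :=
    (ENNReal.tendsto_toReal (measure_ne_top _ _)).comp ht
  obtain ⟨n, hn⟩ := (ht'.eventually (lt_mem_nhds h)).exists
  exact ⟨_, by simp only [gt_iff_lt, lt_add_iff_pos_right]; positivity, hn⟩


lemma nullMeasurableSet_distr (hx : AEMeasurable x volume) (s : ℝ) :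
    NullMeasurableSet {u : I | s < |x u|} volume :=
  nullMeasurableSet_lt aemeasurable_const (continuous_abs.measurable.comp_aemeasurable hx)

/-- The distribution function tends to zero. -/
lemma exists_distr_le (hx : AEMeasurable x volume) {t : ℝ} (h : 0 < t) :
    ∃ s, 0 ≤ s ∧ distr x s ≤ t := by
  have hanti : Antitone (fun n : ℕ => {u : I | (n : ℝ) < |x u|}) := by
    intro m n hmn u hu
    simp only [mem_ofPred_eq] at hu ⊢
    exact lt_of_le_of_lt (by exact_mod_cast hmn) hu
  have ht := tendsto_measure_iInter_atTop (μ := (volume : Measure I))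
    (fun n : ℕ => nullMeasurableSet_distr hx (n : ℝ)) hanti ⟨0, measure_ne_top _ _⟩
  have hE : ⋂ n : ℕ, {u : I | (n : ℝ) < |x u|} = ∅ := by
    ext u
    simp only [mem_iInter, mem_ofPred_eq, mem_empty_iff_false, iff_false, not_forall, not_lt]
    exact exists_nat_ge _
  rw [hE, measure_empty] at ht
  have ht' : Tendsto (fun n : ℕ => distr x n) atTop (𝓝 0) :=
    (ENNReal.tendsto_toReal ENNReal.zero_ne_top).comp ht
  obtain ⟨n, hn⟩ := (ht'.eventually (gt_mem_nhds h)).exists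
  exact ⟨n, n.cast_nonneg, hn.le⟩

lemma rearr_nonneg (t : ℝ) : 0 ≤ rearr x t := Real.sInf_nonneg fun _ hs => hs.1

lemma lt_rearr_iff (hx : AEMeasurable x volume) {s t : ℝ} (hs : 0 ≤ s) (ht : 0 < t) :
    s < rearr x t ↔ t < distr x s := by
  have hb : BddBelow {s : ℝ | 0 ≤ s ∧ distr x s ≤ t} := ⟨0, fun _ h => h.1⟩
  constructor
  · intro h
    by_contra! hc
    exact absurd (csInf_le hb ⟨hs, hc⟩) (not_le.2 h)
  · intro h
    obtain ⟨s', hs', hd⟩ := exists_lt_distr h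
    refine lt_of_lt_of_le hs' (le_csInf (exists_distr_le hx ht) fun r hr => ?_)
    by_contra! hc
    exact absurd (hd.trans_le (distr_antitone hc.le)) (not_lt.2 hr.2)

lemma rearr_antitoneOn (hx : AEMeasurable x volume) : AntitoneOn (rearr x) (Ioi 0) := by
  intro s hs t _ hst
  exact csInf_le_csInf ⟨0, fun _ h => h.1⟩ (exists_distr_le hx hs)
    fun r hr => ⟨hr.1, hr.2.trans hst⟩

/-- The layer cake formula `∫₀¹ x* dψ = ∫₀^∞ ψ(m {|x| > s}) ds`. -/
lemma lorentzENorm_eq (hx : AEMeasurable x volume) :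
    lorentzENorm ψ x = ∫⁻ s in Ioi 0, ENNReal.ofReal (ψ (distr x s)) := by
  have hm : AEMeasurable (rearr x) (ψ.stieltjes.measure.restrict (Ioc 0 1)) :=
    aemeasurable_restrict_of_antitoneOn measurableSet_Ioc
      ((rearr_antitoneOn hx).mono fun t ht => ht.1)
  rw [lorentzENorm, lintegral_eq_lintegral_meas_lt _
    (Eventually.of_forall fun t => rearr_nonneg t) hm]
  refine setLIntegral_congr_fun measurableSet_Ioi fun s hs => ?_
  have hs : 0 < s := hs
  rw [Measure.restrict_apply₀' measurableSet_Ioc.nullMeasurableSet]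
  have hset : {t | s < rearr x t} ∩ Ioc 0 1 = Ioo 0 (distr x s) := by
    ext t
    simp only [mem_inter_iff, mem_ofPred_eq, mem_Ioc, mem_Ioo]
    constructor
    · rintro ⟨h1, h2, _⟩
      exact ⟨h2, (lt_rearr_iff hx hs.le h2).1 h1⟩
    · rintro ⟨h1, h2⟩
      exact ⟨(lt_rearr_iff hx hs.le h1).2 h2, h1, h2.le.trans (distr_le_one s)⟩
  rw [hset, StieltjesFunction.measure_Ioo,
    leftLim_stieltjes,
    stieltjes_eq ψ (distr_nonneg s) (distr_le_one s), stieltjes_eq ψ le_rfl zero_le_one,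
    ψ.map_zero, sub_zero]

lemma lorentzENorm_congr (h : x =ᵐ[volume] y) : lorentzENorm ψ x = lorentzENorm ψ y := by
  have : rearr x = rearr y := by
    funext t
    rw [rearr, rearr, distr_congr h]
  rw [lorentzENorm, lorentzENorm, this]

/-- The right derivative of `ψ`. -/
noncomputable def slopeR (t : ℝ) : ℝ := - derivWithin (-ψ.toFun) (Ioi t) t

lemma slopeR_antitoneOn : AntitoneOn (slopeR ψ) (Ioo 0 1) := by
  have h := ψ.concaveOn.neg.monotoneOn_rightDeriv
  rw [interior_Icc] at h
  exact h.neg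

lemma hasDerivWithinAt_slopeR {t : ℝ} (ht : t ∈ Ioo (0 : ℝ) 1) :
    HasDerivWithinAt ψ (slopeR ψ t) (Ioi t) t := by
  have h := (ψ.concaveOn.neg.hasDerivWithinAt_rightDeriv_of_mem_interior
    (by rwa [interior_Icc])).neg
  rwa [neg_neg] at h

lemma slopeR_nonneg {t : ℝ} (ht : t ∈ Ioo (0 : ℝ) 1) : 0 ≤ slopeR ψ t := by
  have h := (hasDerivWithinAt_iff_tendsto_slope' self_notMem_Ioi).1
    (hasDerivWithinAt_slopeR ψ ht)
  refine ge_of_tendsto h ?_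
  filter_upwards [Ioo_mem_nhdsGT ht.2] with r hr
  rw [slope_def_field]
  exact div_nonneg (sub_nonneg.2 (ψ.monotoneOn ⟨ht.1.le, ht.2.le⟩
    ⟨ht.1.le.trans hr.1.le, hr.2.le⟩ hr.1.le)) (sub_nonneg.2 hr.1.le)

lemma ofReal_eq_lintegral_slopeR {t : ℝ} (h0 : 0 ≤ t) (h1 : t ≤ 1) :
    ENNReal.ofReal (ψ t) = ∫⁻ r in Ioo 0 t, ENNReal.ofReal (slopeR ψ r) := by
  have hc : ContinuousOn ψ (Icc 0 t) := ψ.continuousOn.mono (Icc_subset_Icc_right h1)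
  have hsub : ∀ r ∈ Ioo 0 t, r ∈ Ioo (0 : ℝ) 1 := fun r hr => ⟨hr.1, hr.2.trans_le h1⟩
  have hi : IntegrableOn (slopeR ψ) (Ioc 0 t) :=
    intervalIntegral.integrableOn_deriv_right_of_nonneg hc
      (fun r hr => hasDerivWithinAt_slopeR ψ (hsub r hr)) fun r hr => slopeR_nonneg ψ (hsub r hr)
  have hf := intervalIntegral.integral_eq_sub_of_hasDeriv_right_of_le_real h0 hc
      (fun r hr => hasDerivWithinAt_slopeR ψ (hsub r hr)) ((integrableOn_Icc_iff_integrableOn_Ioc (by simp)).2 hi)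
  rw [ψ.map_zero, sub_zero, intervalIntegral.integral_of_le h0, integral_Ioc_eq_integral_Ioo] at hf
  rw [← hf, ofReal_integral_eq_lintegral_ofReal (hi.mono_set Ioo_subset_Ioc_self)]
  exact (ae_restrict_mem measurableSet_Ioo).mono fun r hr => slopeR_nonneg ψ (hsub r hr)

/-- The length of the interval where the slope of `ψ` exceeds `l`. -/
noncomputable def slopeLevel (l : ℝ) : ℝ≥0∞ := volume ({r | l < slopeR ψ r} ∩ Ioo 0 1)

lemma slopeLevel_antitone : Antitone (slopeLevel ψ) := by
  intro k l hkl
  exact measure_mono fun r hr => ⟨lt_of_le_of_lt hkl hr.1, hr.2⟩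

lemma slopeLevel_ne_top (l : ℝ) : slopeLevel ψ l ≠ ∞ := by
  refine ne_top_of_le_ne_top ?_ (measure_mono inter_subset_right)
  simp

/-- `ψ` is a mixture of the functions `t ↦ min t a`. -/
lemma ofReal_eq_lintegral_min {t : ℝ} (h0 : 0 ≤ t) (h1 : t ≤ 1) :
    ENNReal.ofReal (ψ t) = ∫⁻ l in Ioi 0, min (ENNReal.ofReal t) (slopeLevel ψ l) := by
  have hsub : Ioo 0 t ⊆ Ioo (0 : ℝ) 1 := Ioo_subset_Ioo_right h1
  rw [ofReal_eq_lintegral_slopeR ψ h0 h1, lintegral_eq_lintegral_meas_lt _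
    ((ae_restrict_mem measurableSet_Ioo).mono fun r hr => slopeR_nonneg ψ (hsub hr))
    (aemeasurable_restrict_of_antitoneOn measurableSet_Ioo ((slopeR_antitoneOn ψ).mono hsub))]
  refine lintegral_congr fun l => ?_
  rw [Measure.restrict_apply₀' measurableSet_Ioo.nullMeasurableSet]
  by_cases hl : {r | l < slopeR ψ r} ∩ Ioo 0 1 ⊆ Ioo 0 t
  · have : {r | l < slopeR ψ r} ∩ Ioo 0 t = {r | l < slopeR ψ r} ∩ Ioo 0 1 :=
      Subset.antisymm (inter_subset_inter_right _ hsub) fun r hr => ⟨hr.1, hl hr⟩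
    rw [this, min_eq_right]
    · rfl
    · refine (measure_mono hl).trans ?_
      simp
  · obtain ⟨y, hy, hyt⟩ := not_subset.1 hl
    have hty : t ≤ y := by
      by_contra! hc
      exact hyt ⟨hy.2.1, hc⟩
    have : {r | l < slopeR ψ r} ∩ Ioo 0 t = Ioo 0 t := by
      refine inter_eq_right.2 fun r hr => ?_
      exact lt_of_lt_of_le hy.1 (slopeR_antitoneOn ψ (hsub hr) hy.2 (hr.2.le.trans hty))
    rw [this, min_eq_left]
    · simp
    · have h2 : Ioo 0 t ⊆ {r | l < slopeR ψ r} ∩ Ioo 0 1 :=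
        fun r hr => ⟨by rw [← this] at hr; exact hr.1, hsub hr⟩
      refine le_trans (by simp) (measure_mono h2)

lemma lorentzENorm_eq_mix (hx : AEMeasurable x volume) :
    lorentzENorm ψ x =
      ∫⁻ l in Ioi 0, ∫⁻ s in Ioi 0, min (ENNReal.ofReal (distr x s)) (slopeLevel ψ l) := by
  rw [lorentzENorm_eq ψ hx]
  simp_rw [ofReal_eq_lintegral_min ψ (distr_nonneg _) (distr_le_one _)]
  refine lintegral_lintegral_swap (Measurable.aemeasurable ?_)
  have h1 : Measurable (distr x) := distr_antitone.measurable
  have h2 : Measurable (slopeLevel ψ) := (slopeLevel_antitone ψ).measurable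
  exact (h1.comp measurable_fst).ennreal_ofReal.min (h2.comp measurable_snd)

/-- `∫_c^∞ m {|x| > s} ds = ∫ (|x| - c)₊`. -/
lemma lintegral_Ioi_distr (hx : AEMeasurable x volume) {c : ℝ} :
    ∫⁻ s in Ioi c, ENNReal.ofReal (distr x s) = ∫⁻ u : I, ENNReal.ofReal (|x u| - c) := by
  have hm : AEMeasurable (fun u : I => max (|x u| - c) 0) volume :=
    ((continuous_abs.measurable.comp_aemeasurable hx).sub_const c).max aemeasurable_const
  have h := lintegral_eq_lintegral_meas_lt (volume : Measure I)
    (Eventually.of_forall fun u => le_max_right (|x u| - c) 0) hm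
  have h2 : ∀ u : I, ENNReal.ofReal (max (|x u| - c) 0) = ENNReal.ofReal (|x u| - c) := by
    intro u
    rw [ENNReal.ofReal_max, ENNReal.ofReal_zero, max_eq_left zero_le]
  simp_rw [h2] at h
  rw [h]
  have hmp := measurePreserving_add_right (volume : Measure ℝ) c
  have h3 := hmp.setLIntegral_comp_preimage (s := Ioi c) measurableSet_Ioi
    (f := fun s => ENNReal.ofReal (distr x s)) distr_antitone.measurable.ennreal_ofReal
  rw [← h3]
  have h4 : (fun s : ℝ => s + c) ⁻¹' Ioi c = Ioi 0 := by
    ext s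
    simp
  rw [h4]
  refine setLIntegral_congr_fun measurableSet_Ioi fun s hs => ?_
  have hs : 0 < s := hs
  simp only [ofReal_distr]
  congr 1
  ext u
  simp only [mem_ofPred_eq, lt_max_iff]
  constructor
  · intro h
    left
    linarith
  · rintro (h | h) <;> linarith

/-- `∫₀^∞ min(m {|x| > s}, a) ds`, which equals `∫₀ᵃ x*`. -/
noncomputable def truncInt (x : I → ℝ) (a : ℝ≥0∞) : ℝ≥0∞ :=
  ∫⁻ s in Ioi 0, min (ENNReal.ofReal (distr x s)) a

lemma setLIntegral_Ioi_split (F : ℝ → ℝ≥0∞) {c : ℝ} (hc : 0 ≤ c) :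
    ∫⁻ s in Ioi 0, F s = (∫⁻ s in Ioc 0 c, F s) + ∫⁻ s in Ioi c, F s := by
  rw [← lintegral_union measurableSet_Ioi, Ioc_union_Ioi_eq_Ioi hc]
  exact Ioc_disjoint_Ioi le_rfl

lemma truncInt_le (hx : AEMeasurable x volume) (a : ℝ≥0∞) {c : ℝ} (hc : 0 ≤ c) :
    truncInt x a ≤ a * ENNReal.ofReal c + ∫⁻ u : I, ENNReal.ofReal (|x u| - c) := by
  rw [truncInt, setLIntegral_Ioi_split _ hc, ← lintegral_Ioi_distr hx]
  refine add_le_add ?_ (lintegral_mono fun s => min_le_left _ _)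
  refine (lintegral_mono fun s => min_le_right _ a).trans ?_
  simp

lemma exists_le_truncInt (hx : AEMeasurable x volume) {a : ℝ≥0∞} (ha : a ≠ 0) (ha' : a ≠ ∞) :
    ∃ c : ℝ, 0 ≤ c ∧
      a * ENNReal.ofReal c + ∫⁻ u : I, ENNReal.ofReal (|x u| - c) ≤ truncInt x a := by
  have ht : 0 < a.toReal := ENNReal.toReal_pos ha ha'
  set c := rearr x a.toReal with hcdef
  have hc : 0 ≤ c := rearr_nonneg _
  refine ⟨c, hc, ?_⟩
  rw [truncInt, setLIntegral_Ioi_split _ hc, ← lintegral_Ioi_distr hx]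
  refine add_le_add ?_ ?_
  · have : a * ENNReal.ofReal c = ∫⁻ _ in Ioo 0 c, a := by simp
    rw [this]
    refine (setLIntegral_mono' measurableSet_Ioo fun s hs => ?_).trans
      (lintegral_mono_set Ioo_subset_Ioc_self)
    refine le_min ?_ le_rfl
    rw [← ENNReal.ofReal_toReal ha']
    exact ENNReal.ofReal_le_ofReal ((lt_rearr_iff hx hs.1.le ht).1 hs.2).le
  · refine setLIntegral_mono' measurableSet_Ioi fun s hs => le_min le_rfl ?_
    have hs : c < s := hs
    rw [← ENNReal.ofReal_toReal ha']
    refine ENNReal.ofReal_le_ofReal (not_lt.1 fun h => ?_)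
    exact absurd ((lt_rearr_iff hx (hc.trans hs.le) ht).2 h) (not_lt.2 hs.le)

lemma truncInt_add_le (hx : AEMeasurable x volume) (hy : AEMeasurable y volume)
    {a : ℝ≥0∞} (ha' : a ≠ ∞) :
    truncInt (x + y) a ≤ truncInt x a + truncInt y a := by
  rcases eq_or_ne a 0 with rfl | ha
  · simp [truncInt]
  obtain ⟨c, hc, hcx⟩ := exists_le_truncInt hx ha ha'
  obtain ⟨d, hd, hdy⟩ := exists_le_truncInt hy ha ha'
  refine (truncInt_le (hx.add hy) a (add_nonneg hc hd)).trans ?_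
  refine le_trans ?_ (add_le_add hcx hdy)
  rw [ENNReal.ofReal_add hc hd, mul_add, add_add_add_comm]
  gcongr
  rw [← lintegral_add_left']
  · refine lintegral_mono fun u => ?_
    refine le_trans (ENNReal.ofReal_le_ofReal ?_) ENNReal.ofReal_add_le
    have := abs_add_le (x u) (y u)
    simp only [Pi.add_apply]
    linarith
  · exact ((continuous_abs.measurable.comp_aemeasurable hx).sub_const c).ennreal_ofReal

lemma lorentzENorm_add_le (hx : AEMeasurable x volume) (hy : AEMeasurable y volume) :
    lorentzENorm ψ (x + y) ≤ lorentzENorm ψ x + lorentzENorm ψ y := by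
  rw [lorentzENorm_eq_mix ψ hx, lorentzENorm_eq_mix ψ hy, lorentzENorm_eq_mix ψ (hx.add hy)]
  refine (lintegral_mono fun l =>
    truncInt_add_le hx hy (slopeLevel_ne_top ψ l)).trans_eq ?_
  refine lintegral_add_left ?_ _
  refine Antitone.measurable fun k l hkl => lintegral_mono fun s => ?_
  exact min_le_min le_rfl (slopeLevel_antitone ψ hkl)

lemma distr_smul {c : ℝ} (hc : c ≠ 0) (s : ℝ) : distr (c • x) (|c| * s) = distr x s := by
  unfold distr
  congr 1
  ext u
  simp only [mem_ofPred_eq, Pi.smul_apply, smul_eq_mul, abs_mul]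
  exact mul_lt_mul_iff_right₀ (abs_pos.2 hc)

lemma rearr_smul {c : ℝ} (hc : c ≠ 0) (t : ℝ) : rearr (c • x) t = |c| * rearr x t := by
  have hc' : 0 < |c| := abs_pos.2 hc
  rw [rearr, rearr, ← smul_eq_mul, ← Real.sInf_smul_of_nonneg hc'.le]
  congr 1
  ext s
  rw [mem_smul_set_iff_inv_smul_mem₀ hc'.ne']
  simp only [mem_ofPred_eq, smul_eq_mul]
  rw [← distr_smul hc (|c|⁻¹ * s), mul_inv_cancel_left₀ hc'.ne']
  rw [mul_nonneg_iff_of_pos_left (inv_pos.2 hc')]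

lemma lorentzENorm_zero : lorentzENorm ψ (0 : I → ℝ) = 0 := by
  rw [lorentzENorm_eq ψ (x := 0) (aemeasurable_const (b := (0 : ℝ)))]
  refine (setLIntegral_congr_fun measurableSet_Ioi fun s hs => ?_).trans lintegral_zero
  have hs : ¬ s < 0 := not_lt.2 (le_of_lt hs)
  simp [distr, hs, ψ.map_zero]

lemma lorentzENorm_smul (c : ℝ) :
    lorentzENorm ψ (c • x) = ENNReal.ofReal |c| * lorentzENorm ψ x := by
  rcases eq_or_ne c 0 with rfl | hc
  · simp [lorentzENorm_zero]
  · rw [lorentzENorm, lorentzENorm, ← lintegral_const_mul' _ _ ENNReal.ofReal_ne_top]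
    refine lintegral_congr fun t => ?_
    rw [rearr_smul hc, ENNReal.ofReal_mul (abs_nonneg c)]

lemma ae_eq_zero_of_lorentzENorm_eq_zero (hx : AEMeasurable x volume)
    (h : lorentzENorm ψ x = 0) : x =ᵐ[volume] 0 := by
  have hd : ∀ s > 0, distr x s = 0 := by
    intro s hs
    by_contra hne
    have hpos : 0 < ψ (distr x s) :=
      ψ.pos (lt_of_le_of_ne (distr_nonneg s) (Ne.symm hne)) (distr_le_one s)
    have hle : ∫⁻ _ in Ioc 0 s, ENNReal.ofReal (ψ (distr x s)) ≤ lorentzENorm ψ x := by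
      rw [lorentzENorm_eq ψ hx]
      refine (setLIntegral_mono' measurableSet_Ioc fun r hr => ?_).trans
        (lintegral_mono_set Ioc_subset_Ioi_self)
      exact ENNReal.ofReal_le_ofReal (ψ.monotoneOn ⟨distr_nonneg _, distr_le_one _⟩
        ⟨distr_nonneg _, distr_le_one _⟩ (distr_antitone hr.2))
    rw [h, nonpos_iff_eq_zero] at hle
    simp at hle
    rcases hle with hle | hle <;> linarith
  have hall : ∀ᵐ u : I, ∀ n : ℕ, |x u| ≤ 1 / ((n : ℝ) + 1) := by
    rw [ae_all_iff]
    intro n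
    have := hd (1 / ((n : ℝ) + 1)) (by positivity)
    rw [ae_iff]
    simp only [not_le]
    rw [← ofReal_distr, this, ENNReal.ofReal_zero]
  filter_upwards [hall] with u hu
  have : |x u| ≤ 0 := by
    by_contra! hc
    obtain ⟨n, hn⟩ := exists_nat_one_div_lt hc
    exact absurd (hu n) (not_le.2 hn)
  simpa using this

end Aux

/-! ### The Lorentz space -/

/-- The Lorentz space `Λ(ψ)` on `[0,1]`: all (classes of a.e. equal) measurable functions with
`∫₀¹ x* dψ < ∞`. -/
noncomputable def Lorentz (ψ : LorentzWeight) : Submodule ℝ (I →ₘ[volume] ℝ) where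
  carrier := {x | lorentzENorm ψ x < ∞}
  zero_mem' := by
    rw [mem_ofPred_eq, lorentzENorm_congr ψ AEEqFun.coeFn_zero, lorentzENorm_zero]
    exact ENNReal.zero_lt_top
  add_mem' := by
    intro x y hx hy
    rw [mem_ofPred_eq, lorentzENorm_congr ψ (AEEqFun.coeFn_add x y)]
    exact (lorentzENorm_add_le ψ x.aemeasurable y.aemeasurable).trans_lt
      (ENNReal.add_lt_top.2 ⟨hx, hy⟩)
  smul_mem' := by
    intro c x hx
    rw [mem_ofPred_eq, lorentzENorm_congr ψ (AEEqFun.coeFn_smul c x), lorentzENorm_smul]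
    exact ENNReal.mul_lt_top ENNReal.ofReal_lt_top hx

noncomputable instance (ψ : LorentzWeight) : Norm (Lorentz ψ) :=
  ⟨fun x => (lorentzENorm ψ (x : I →ₘ[volume] ℝ)).toReal⟩

lemma norm_def {ψ : LorentzWeight} (x : Lorentz ψ) :
    ‖x‖ = (lorentzENorm ψ (x : I →ₘ[volume] ℝ)).toReal := rfl

lemma lorentz_core (ψ : LorentzWeight) : NormedSpace.Core ℝ (Lorentz ψ) where
  norm_nonneg x := ENNReal.toReal_nonneg
  norm_smul c x := by
    rw [norm_def, norm_def, Submodule.coe_smul, lorentzENorm_congr ψ (AEEqFun.coeFn_smul c _),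
      lorentzENorm_smul, ENNReal.toReal_mul, ENNReal.toReal_ofReal (abs_nonneg c), Real.norm_eq_abs]
  norm_triangle x y := by
    rw [norm_def, norm_def, norm_def, Submodule.coe_add,
      lorentzENorm_congr ψ (AEEqFun.coeFn_add _ _), ← ENNReal.toReal_add x.2.ne y.2.ne]
    exact ENNReal.toReal_mono (ENNReal.add_lt_top.2 ⟨x.2, y.2⟩).ne
      (lorentzENorm_add_le ψ x.1.aemeasurable y.1.aemeasurable)
  norm_eq_zero_iff x := by
    constructor
    · intro h
      rw [norm_def, ENNReal.toReal_eq_zero_iff] at h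
      have h0 := h.resolve_right x.2.ne
      apply Subtype.ext
      exact AEEqFun.ext ((ae_eq_zero_of_lorentzENorm_eq_zero ψ x.1.aemeasurable h0).trans
        AEEqFun.coeFn_zero.symm)
    · rintro rfl
      rw [norm_def, Submodule.coe_zero, lorentzENorm_congr ψ AEEqFun.coeFn_zero, lorentzENorm_zero,
        ENNReal.toReal_zero]

noncomputable instance (ψ : LorentzWeight) : NormedAddCommGroup (Lorentz ψ) :=
  NormedAddCommGroup.ofCore (lorentz_core ψ)

noncomputable instance (ψ : LorentzWeight) : NormedSpace ℝ (Lorentz ψ) :=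
  NormedSpace.ofCore (lorentz_core ψ)

/-! ### Banach–Saks index sets -/

section BanachSaks

variable {E : Type*} [NormedAddCommGroup E] [NormedSpace ℝ E]

/-- `x` converges weakly to zero. -/
def IsWeaklyNull (x : ℕ → E) : Prop :=
  ∀ g : StrongDual ℝ E, Tendsto (fun n => g (x n)) atTop (𝓝 0)

/-- `p`-BS-sequences: bounded sequences such that
`sup_m m^{-1/p} ‖y 1 + ⋯ + y m‖ < ∞` for all subsequences `y`. -/
def IsBanachSaksSeq (p : ℝ) (x : ℕ → E) : Prop :=
  Bornology.IsBounded (range x) ∧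
    ∀ n : ℕ → ℕ, StrictMono n →
      ∃ C : ℝ, ∀ m : ℕ, 1 ≤ m → (m : ℝ) ^ (-(1 / p)) * ‖∑ k ∈ Finset.range m, x (n k)‖ ≤ C

end BanachSaks

/-- The functions `x n` on the probability space `([0,1], m)` are independent and identically
distributed. -/
def IsIID (x : ℕ → I →ₘ[volume] ℝ) : Prop :=
  iIndepFun (fun n => (x n : I → ℝ)) volume ∧
    ∀ n, IdentDistrib (x n : I → ℝ) (x 0 : I → ℝ) volume volume

/-- The index set `Γ_iid(Λ(ψ))`: all `p ≥ 1` such that each weakly null sequence of independent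
identically distributed elements of `Λ(ψ)` contains a `p`-BS-sequence. -/
def gammaIid (ψ : LorentzWeight) : Set ℝ :=
  {p | 1 ≤ p ∧ ∀ x : ℕ → Lorentz ψ, IsWeaklyNull x →
    IsIID (fun n => (x n : I →ₘ[volume] ℝ)) →
    ∃ n : ℕ → ℕ, StrictMono n ∧ IsBanachSaksSeq p (x ∘ n)}

end LorentzBS

/-! The layer cake formula `lorentzENorm_eq` turns the norm into `∫₀^∞ ψ(m{|x| > s}) ds`, so
everything reduces to tail estimates for sums of independent functions. The basic case is a centred
sum of `N` independent indicators of sets of measure `u`. By the triangle inequality its norm is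
`O(N ψ(u))`, and the question is whether a power of `N` can be gained uniformly in `u`.

Linear growth can occur in two ways. If the indicators were disjoint, the norm would be about
`ψ(Nu)`, and this is sublinear in `N` by the first limit condition. If all of them occur at once,
which has probability `u ^ N`, the norm is at least `N ψ(u ^ N)`, and this is sublinear by the
second. The conditions yield `ψ(tu) ≤ C t^α ψ(u)` with `α < 1` (`exists_dilation_bound`) and `ψ(v^T)
≤ C T^(-β) ψ(v)` (`exists_power_bound`). Splitting the levels at `N ^ (1/q)` with `q < 2` and `qα <
1`, moment bounds control the lower levels and exponential inequalities the upper ones; this gives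
`C N^r ψ(u)` with `r < 1` (`exists_bernoulli_bound`). Slicing a nonnegative function into indicators
transfers the bound to independent copies of any element of the space, up to an additive constant
(`lorentzENorm_sum_iid_le`). A weakly null i.i.d. sequence has mean zero, so `1/r` lies in the index
set.

Conversely, if a condition fails, then for each `N` there are arbitrarily small `u` for which one of
the two scenarios gives a norm comparable to `N ψ(u)` (`exists_isExtremal`). A single odd function
collects such steps for `N = 2^((j+1)^2)` with weights `2^(-j)`. Its independent copies are weakly
null by a law of large numbers in norm (`isWeaklyNull_of_ae_eq`), while the sums over every
subsequence exceed `N 2^(-j) / 8`, which no `N^(1/p)` with `p > 1` dominates. The index `1` always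
belongs to the set, by the triangle inequality. -/

namespace LorentzBS

/-! ### Growth of the weight near zero -/

section Weight

variable (ψ : LorentzWeight)

lemma LorentzWeight.mono {a b : ℝ} (ha : 0 ≤ a) (hab : a ≤ b) (hb : b ≤ 1) : ψ a ≤ ψ b :=
  ψ.monotoneOn ⟨ha, hab.trans hb⟩ ⟨ha.trans hab, hb⟩ hab

lemma LorentzWeight.mul_le {c x : ℝ} (hc : 0 ≤ c) (hc1 : c ≤ 1) (hx : 0 ≤ x) (hx1 : x ≤ 1) :
    c * ψ x ≤ ψ (c * x) := by
  have h := ψ.concaveOn.2 (x := x) (y := 0) ⟨hx, hx1⟩ (left_mem_Icc.2 zero_le_one) hc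
    (sub_nonneg.2 hc1) (by ring)
  simpa [ψ.map_zero] using h

lemma LorentzWeight.le_mul {t x : ℝ} (ht : 1 ≤ t) (hx : 0 ≤ x) (h1 : t * x ≤ 1) :
    ψ (t * x) ≤ t * ψ x := by
  have h := ψ.mul_le (inv_nonneg.2 (zero_le_one.trans ht)) (inv_le_one_of_one_le₀ ht)
    (x := t * x) (by positivity) h1
  rw [inv_mul_cancel_left₀ (by positivity)] at h
  rwa [inv_mul_le_iff₀ (by positivity)] at h

lemma eventually_mem_Ioo {c : ℝ} (hc : 0 < c) : ∀ᶠ u : ℝ in 𝓝[>] 0, u ∈ Ioo 0 c :=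
  Ioo_mem_nhdsGT hc

/-- A real-valued `limsup` is informative only for bounded functions. Here monotonicity gives the
lower bound and concavity the upper one. -/
lemma eventually_ratio_mul {k : ℕ} (hk : 2 ≤ k) :
    ∀ᶠ u : ℝ in 𝓝[>] 0, ψ (k * u) / ψ u ∈ Icc (1 : ℝ) k := by
  have hk' : (1 : ℝ) ≤ k := by exact_mod_cast (by omega : 1 ≤ k)
  have hk0 : (0 : ℝ) < k := by linarith
  filter_upwards [eventually_mem_Ioo (c := 1 / (k : ℝ)) (by positivity)] with u hu
  have h1 : (k : ℝ) * u ≤ 1 := by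
    have := (lt_div_iff₀ hk0).1 hu.2
    linarith
  have h2 : u ≤ k * u := le_mul_of_one_le_left hu.1.le hk'
  have hpos := ψ.pos hu.1 (h2.trans h1)
  exact ⟨(one_le_div hpos).2 (ψ.mono hu.1.le h2 h1), (div_le_iff₀ hpos).2 (ψ.le_mul hk' hu.1.le h1)⟩

lemma eventually_ratio_pow {l : ℕ} (hl : 2 ≤ l) :
    ∀ᶠ u : ℝ in 𝓝[>] 0, ψ (u ^ l) / ψ u ∈ Icc (0 : ℝ) 1 := by
  filter_upwards [eventually_mem_Ioo (c := 1) one_pos] with u hu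
  have h1 : u ^ l ≤ u := pow_le_of_le_one hu.1.le hu.2.le (by omega)
  have hpos := ψ.pos hu.1 hu.2.le
  exact ⟨div_nonneg (ψ.nonneg (pow_nonneg hu.1.le _) (h1.trans hu.2.le)) hpos.le,
    (div_le_one hpos).2 (ψ.mono (pow_nonneg hu.1.le _) h1 hu.2.le)⟩

lemma isBoundedUnder_of_eventually_mem_Icc {f : ℝ → ℝ} {a b : ℝ} {F : Filter ℝ}
    (h : ∀ᶠ u in F, f u ∈ Icc a b) :
    IsBoundedUnder (· ≤ ·) F f ∧ IsBoundedUnder (· ≥ ·) F f :=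
  ⟨⟨b, eventually_map.2 (h.mono fun _ hu => hu.2)⟩, ⟨a, eventually_map.2 (h.mono fun _ hu => hu.1)⟩⟩

/-- The lower bound `d` on `ρ` is there for the logarithms taken later: `d = 1` gives `log ρ > 0`,
and `d = 0` makes `log ρ` meaningful. -/
lemma exists_lt_of_limsup_lt {f : ℝ → ℝ} {a b c d : ℝ}
    (h : ∀ᶠ u in 𝓝[>] 0, f u ∈ Icc a b) (hf : limsup f (𝓝[>] 0) < c) (hd : d < c) :
    ∃ ρ, d < ρ ∧ ρ < c ∧ ∃ u₀ > 0, ∀ u ∈ Ioo 0 u₀, f u < ρ := by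
  obtain ⟨ρ, h1, h2⟩ := exists_between (max_lt hf hd)
  have h3 := eventually_lt_of_limsup_lt ((le_max_left _ _).trans_lt h1)
    (isBoundedUnder_of_eventually_mem_Icc h).1
  obtain ⟨u₀, hu₀, hsub⟩ := mem_nhdsGT_iff_exists_Ioo_subset.1 h3
  exact ⟨ρ, (le_max_right _ _).trans_lt h1, h2, u₀, hu₀, fun u hu => hsub hu⟩

lemma exists_gt_of_le_limsup {f : ℝ → ℝ} {a b c d δ : ℝ}
    (h : ∀ᶠ u in 𝓝[>] 0, f u ∈ Icc a b) (hf : c ≤ limsup f (𝓝[>] 0)) (hd : d < c) (hδ : 0 < δ) :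
    ∃ u ∈ Ioo 0 δ, d < f u := by
  have h1 := frequently_lt_of_lt_limsup
    (isBoundedUnder_of_eventually_mem_Icc h).2.isCoboundedUnder_le (hd.trans_le hf)
  obtain ⟨u, hu, hu'⟩ := (h1.and_eventually (eventually_mem_Ioo hδ)).exists
  exact ⟨u, hu', hu⟩

/-- A weight with `limsup ψ(ku)/ψ(u) < k` has upper dilation index less than one. -/
lemma exists_dilation_bound {k : ℕ} (hk : 2 ≤ k)
    (h : limsup (fun u : ℝ => ψ (k * u) / ψ u) (𝓝[>] 0) < k) :
    ∃ α C : ℝ, 0 < α ∧ α < 1 ∧ 0 < C ∧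
      ∀ t u : ℝ, 1 ≤ t → 0 < u → u ≤ 1 → ψ (min 1 (t * u)) ≤ C * t ^ α * ψ u := by
  have hk1 : (1 : ℝ) < k := by exact_mod_cast (by omega : 1 < k)
  obtain ⟨ρ, hρ1, hρk, u₀, hu₀, hρ⟩ :=
    exists_lt_of_limsup_lt (eventually_ratio_mul ψ hk) h hk1
  have hk0 : (0 : ℝ) < k := by linarith
  have hρ0 : 0 < ρ := by linarith
  have hlk : 0 < Real.log k := Real.log_pos hk1
  -- Chosen so that `k ^ α = ρ`; then `1 < ρ < k` gives `0 < α < 1`.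
  set α := Real.log ρ / Real.log k with hα
  have hα0 : 0 < α := div_pos (Real.log_pos hρ1) hlk
  have hkα : (k : ℝ) ^ α = ρ := by
    rw [Real.rpow_def_of_pos hk0, hα, mul_div_cancel₀ _ hlk.ne', Real.exp_log hρ0]
  set c := min u₀ 1 / k with hc
  have hm0 : 0 < min u₀ 1 := lt_min hu₀ one_pos
  have hc0 : 0 < c := div_pos hm0 hk0
  have hkc : k * c = min u₀ 1 := by rw [hc]; field_simp
  have hc1 : c < 1 := by
    have := min_le_right u₀ 1
    nlinarith
  have iter : ∀ (v : ℝ) (m : ℕ), 0 < v → (k : ℝ) ^ m * v < min u₀ 1 → ψ (k ^ m * v) ≤ ρ ^ m * ψ v := by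
    intro v m hv
    induction m with
    | zero => intro _; simp
    | succ m ih =>
      intro hm
      have h1 : (k : ℝ) ^ m * v ≤ k ^ (m + 1) * v := by
        gcongr
        · exact hk1.le
        · omega
      have h2 : 0 < (k : ℝ) ^ m * v := by positivity
      have h3 := hρ _ ⟨h2, h1.trans_lt (hm.trans_le (min_le_left _ _))⟩
      rw [div_lt_iff₀ (ψ.pos h2 (h1.trans (hm.le.trans (min_le_right _ _))))] at h3
      have h4 := ih (h1.trans_lt hm)
      calc ψ (k ^ (m + 1) * v) = ψ (k * (k ^ m * v)) := by ring_nf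
        _ ≤ ρ * ψ (k ^ m * v) := h3.le
        _ ≤ ρ * (ρ ^ m * ψ v) := by gcongr
        _ = ρ ^ (m + 1) * ψ v := by ring
  have key : ∀ t u : ℝ, 1 ≤ t → 0 < u → t * u ≤ 1 → ψ (t * u) ≤ (2 * ρ / c) * t ^ α * ψ u := by
    intro t u ht hu htu
    obtain ⟨m, hm1, hm2⟩ := exists_nat_pow_near ht hk1
    have hu1 : u ≤ 1 := (le_mul_of_one_le_left hu.le ht).trans htu
    -- Shrinking by `d` keeps the whole orbit `k^i d u` in the region where the ratio bound holds;
    -- concavity, `d ψ(tu) ≤ ψ(d t u)`, undoes the shrinking at the cost of a constant.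
    set d := c / 2 with hd
    have hd0 : 0 < d := by positivity
    have hd1 : d ≤ 1 := by linarith
    have h1 : d * ψ (t * u) ≤ ψ (d * (t * u)) := ψ.mul_le hd0.le hd1 (by positivity) htu
    have h2 : (k : ℝ) ^ (m + 1) * (d * u) < min u₀ 1 := by
      rw [← hkc]
      calc (k : ℝ) ^ (m + 1) * (d * u) = k * d * (k ^ m * u) := by ring
        _ ≤ k * d * (t * u) := by gcongr
        _ ≤ k * d * 1 := by gcongr
        _ < k * c := by rw [mul_one]; gcongr; linarith
    have h3 := iter (d * u) (m + 1) (by positivity) h2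
    have h4 : ψ (d * (t * u)) ≤ ψ (k ^ (m + 1) * (d * u)) := by
      refine ψ.mono (by positivity) ?_ (h2.le.trans (min_le_right _ _))
      rw [mul_left_comm]
      gcongr
    have h5 : ψ (d * u) ≤ ψ u := ψ.mono (by positivity) (mul_le_of_le_one_left hu.le hd1) hu1
    have h6 : ρ ^ m ≤ t ^ α := by
      rw [← hkα, ← Real.rpow_natCast, ← Real.rpow_mul hk0.le, mul_comm, Real.rpow_mul hk0.le,
        Real.rpow_natCast]
      exact Real.rpow_le_rpow (by positivity) hm1 hα0.le
    have hψu := ψ.pos hu hu1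
    have h7 : d * ψ (t * u) ≤ ρ * t ^ α * ψ u :=
      calc d * ψ (t * u) ≤ ρ ^ (m + 1) * ψ (d * u) := h1.trans (h4.trans h3)
        _ ≤ ρ ^ (m + 1) * ψ u := by gcongr
        _ = ρ * ρ ^ m * ψ u := by ring
        _ ≤ ρ * t ^ α * ψ u := by gcongr
    have h8 : (2 * ρ / c) * t ^ α * ψ u = (ρ * t ^ α * ψ u) / d := by
      rw [hd]; field_simp
    rw [h8, le_div_iff₀ hd0]
    linarith
  refine ⟨α, 2 * ρ / c, hα0, (div_lt_one hlk).2 (Real.log_lt_log hρ0 hρk), by positivity, ?_⟩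
  intro t u ht hu hu1
  have hψu := ψ.pos hu hu1
  rcases le_total (t * u) 1 with htu | htu
  · rw [min_eq_right htu]
    exact key t u ht hu htu
  · rw [min_eq_left htu]
    -- Beyond `tu = 1` the left side is frozen at `ψ 1`, which is the case `t = 1 / u`.
    have h1 := key (1 / u) u ((one_le_div hu).2 hu1) hu (by rw [one_div_mul_cancel hu.ne'])
    rw [one_div_mul_cancel hu.ne'] at h1
    refine h1.trans ?_
    have : 1 / u ≤ t := (div_le_iff₀ hu).2 htu
    gcongr

/-- A weight with `limsup ψ(uˡ)/ψ(u) < 1` decays at least like a power of `1/T` along `v ^ T`. -/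
lemma exists_power_bound {l : ℕ} (hl : 2 ≤ l)
    (h : limsup (fun u : ℝ => ψ (u ^ l) / ψ u) (𝓝[>] 0) < 1) :
    ∃ β C : ℝ, 0 < β ∧ 0 < C ∧
      ∀ T v : ℝ, 1 ≤ T → 0 < v → v ≤ 1 / 2 → ψ (v ^ T) ≤ C * T ^ (-β) * ψ v := by
  obtain ⟨ρ, hρ0, hρ1, u₀, hu₀, hρ⟩ :=
    exists_lt_of_limsup_lt (eventually_ratio_pow ψ hl) h one_pos
  have hl1 : (1 : ℝ) < l := by exact_mod_cast (by omega : 1 < l)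
  have hl0 : (0 : ℝ) < l := by linarith
  have hll : 0 < Real.log l := Real.log_pos hl1
  -- Chosen so that `l ^ (-β) = ρ`: each `l`-th power costs a factor `ρ`.
  set β := -Real.log ρ / Real.log l with hβ
  have hβ0 : 0 < β := div_pos (neg_pos.2 (Real.log_neg hρ0 hρ1)) hll
  have hlβ : (l : ℝ) ^ (-β) = ρ := by
    rw [Real.rpow_def_of_pos hl0, hβ, neg_div, neg_neg, mul_div_cancel₀ _ hll.ne', Real.exp_log hρ0]
  have iter : ∀ (w : ℝ) (m : ℕ), 0 < w → w < min u₀ 1 → ψ (w ^ (l ^ m)) ≤ ρ ^ m * ψ w := by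
    intro w m hw hw1
    induction m with
    | zero => simp
    | succ m ih =>
      have hw2 : w ^ (l ^ m) ≤ w :=
        pow_le_of_le_one hw.le (hw1.le.trans (min_le_right _ _)) (pow_ne_zero _ (by omega))
      have hw3 : 0 < w ^ (l ^ m) := by positivity
      have h3 := hρ _ ⟨hw3, hw2.trans_lt (hw1.trans_le (min_le_left _ _))⟩
      rw [div_lt_iff₀ (ψ.pos hw3 (hw2.trans (hw1.le.trans (min_le_right _ _))))] at h3
      calc ψ (w ^ (l ^ (m + 1))) = ψ ((w ^ (l ^ m)) ^ l) := by rw [← pow_mul, pow_succ]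
        _ ≤ ρ * ψ (w ^ (l ^ m)) := h3.le
        _ ≤ ρ * (ρ ^ m * ψ w) := by gcongr
        _ = ρ ^ (m + 1) * ψ w := by ring
  -- Passing from `v` to `v ^ j` brings every `v ≤ 1/2` into the range where the iteration is valid.
  -- The constant `(j l)^β` pays for this and for rounding `T / j` down to a power of `l`; for `T <
  -- j` it makes the bound trivial.
  obtain ⟨n, hn⟩ := exists_pow_lt_of_lt_one (lt_min hu₀ one_pos) (by norm_num : (1 / 2 : ℝ) < 1)
  set j := n + 1 with hj
  have hjpos : (0 : ℝ) < j := by positivity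
  refine ⟨β, (j * l) ^ β, hβ0, by positivity, ?_⟩
  intro T v hT hv hv1
  have hvle : v ≤ 1 := by linarith
  have hψv := ψ.pos hv hvle
  have hT0 : 0 < T := by linarith
  have hCT : (j * l : ℝ) ^ β * T ^ (-β) = (T / (j * l)) ^ (-β) := by
    rw [Real.div_rpow hT0.le (by positivity), Real.rpow_neg (by positivity : (0 : ℝ) ≤ j * l)]
    field_simp
  rw [hCT]
  rcases lt_or_ge T j with hTj | hTj
  · have h1 : ψ (v ^ T) ≤ ψ v :=
      ψ.mono (by positivity) (Real.rpow_le_self_of_le_one hv.le hvle hT) hvle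
    have h2 : 1 ≤ (T / (j * l)) ^ (-β) := by
      refine Real.one_le_rpow_of_pos_of_le_one_of_nonpos (by positivity) ?_ (by linarith)
      rw [div_le_one (by positivity)]
      nlinarith
    exact h1.trans (le_mul_of_one_le_left hψv.le h2)
  · obtain ⟨m, hm1, hm2⟩ := exists_nat_pow_near ((one_le_div hjpos).2 hTj) hl1
    have hvj : v ^ j < min u₀ 1 :=
      calc v ^ j ≤ (1 / 2) ^ j := by gcongr
        _ ≤ (1 / 2) ^ n := pow_le_pow_of_le_one (by norm_num) (by norm_num) (by omega)
        _ < _ := hn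
    have h1 := iter (v ^ j) m (by positivity) hvj
    have h2 : v ^ T ≤ (v ^ j) ^ (l ^ m) := by
      rw [← pow_mul, ← Real.rpow_natCast]
      refine Real.rpow_le_rpow_of_exponent_ge hv hvle ?_
      push_cast
      rw [le_div_iff₀ hjpos] at hm1
      linarith
    have h3 : ψ (v ^ j) ≤ ψ v := ψ.mono (by positivity) (pow_le_of_le_one hv.le hvle (by omega)) hvle
    have h4 : ρ ^ m ≤ (T / (j * l)) ^ (-β) := by
      rw [← hlβ, ← Real.rpow_natCast, ← Real.rpow_mul hl0.le, mul_comm, Real.rpow_mul hl0.le,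
        Real.rpow_natCast]
      refine Real.rpow_le_rpow_of_nonpos (by positivity) ?_ (by linarith)
      rw [← div_div, div_le_iff₀ hl0, ← pow_succ]
      exact hm2.le
    calc ψ (v ^ T) ≤ ψ ((v ^ j) ^ (l ^ m)) := ψ.mono (by positivity) h2
          (pow_le_one₀ (by positivity) (pow_le_one₀ hv.le hvle))
      _ ≤ ρ ^ m * ψ (v ^ j) := h1
      _ ≤ ρ ^ m * ψ v := by gcongr
      _ ≤ _ := by gcongr

/-- The negation bounds the `limsup` below for every integer at once, so `N` is at the caller's
choice. The factor `1/2` is the room needed to pass from the `limsup` to actual points. -/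
lemma exists_half_mul_le
    (h : ¬ ∃ k : ℕ, 2 ≤ k ∧ limsup (fun u : ℝ => ψ (k * u) / ψ u) (𝓝[>] 0) < k)
    {N : ℕ} (hN : 2 ≤ N) {δ : ℝ} (hδ : 0 < δ) :
    ∃ u ∈ Ioo 0 (min δ 1), N * ψ u / 2 ≤ ψ (N * u) := by
  push Not at h
  have hN0 : (0 : ℝ) < N := by positivity
  obtain ⟨u, hu, hr⟩ := exists_gt_of_le_limsup (eventually_ratio_mul ψ hN) (h N hN)
    (half_lt_self hN0) (lt_min hδ one_pos)
  refine ⟨u, hu, ?_⟩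
  rw [lt_div_iff₀ (ψ.pos hu.1 (hu.2.le.trans (min_le_right _ _)))] at hr
  linarith

lemma exists_half_le_pow
    (h : ¬ ∃ l : ℕ, 2 ≤ l ∧ limsup (fun u : ℝ => ψ (u ^ l) / ψ u) (𝓝[>] 0) < 1)
    {N : ℕ} (hN : 2 ≤ N) {δ : ℝ} (hδ : 0 < δ) :
    ∃ u ∈ Ioo 0 (min δ 1), ψ u / 2 ≤ ψ (u ^ N) := by
  push Not at h
  obtain ⟨u, hu, hr⟩ := exists_gt_of_le_limsup (eventually_ratio_pow ψ hN) (h N hN)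
    (by norm_num : (1 / 2 : ℝ) < 1) (lt_min hδ one_pos)
  refine ⟨u, hu, ?_⟩
  rw [lt_div_iff₀ (ψ.pos hu.1 (hu.2.le.trans (min_le_right _ _)))] at hr
  linarith

end Weight

/-! ### Further properties of the Lorentz functional -/

section Functional

variable (ψ : LorentzWeight) {x y : I → ℝ}

lemma LorentzWeight.one_pos : 0 < ψ 1 := ψ.pos zero_lt_one le_rfl

lemma LorentzWeight.mono_distr {a b : ℝ} (ha : 0 ≤ a) (hab : a ≤ b) (hb : b ≤ 1) :
    ENNReal.ofReal (ψ a) ≤ ENNReal.ofReal (ψ b) :=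
  ENNReal.ofReal_le_ofReal (ψ.mono ha hab hb)

lemma distr_mono (h : ∀ u, |x u| ≤ |y u|) (s : ℝ) : distr x s ≤ distr y s :=
  measureReal_mono fun u (hu : s < |x u|) => hu.trans_le (h u)

lemma distr_eq_of_identDistrib (h : IdentDistrib x y volume volume) : distr x = distr y := by
  funext s
  have hm : MeasurableSet {r : ℝ | s < |r|} := measurableSet_lt measurable_const measurable_norm
  exact congrArg ENNReal.toReal (h.measure_mem_eq hm)

lemma lorentzENorm_eq_of_identDistrib (h : IdentDistrib x y volume volume) :
    lorentzENorm ψ x = lorentzENorm ψ y := by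
  rw [lorentzENorm_eq ψ h.aemeasurable_fst, lorentzENorm_eq ψ h.aemeasurable_snd,
    distr_eq_of_identDistrib h]

lemma lorentzENorm_mono (hx : AEMeasurable x volume) (hy : AEMeasurable y volume)
    (h : ∀ u, |x u| ≤ |y u|) : lorentzENorm ψ x ≤ lorentzENorm ψ y := by
  rw [lorentzENorm_eq ψ hx, lorentzENorm_eq ψ hy]
  exact lintegral_mono fun s => ψ.mono_distr (distr_nonneg s) (distr_mono h s) (distr_le_one s)

lemma lorentzENorm_neg : lorentzENorm ψ (-x) = lorentzENorm ψ x := by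
  simpa using lorentzENorm_smul ψ (x := x) (-1)

lemma lorentzENorm_sub_le (hx : AEMeasurable x volume) (hy : AEMeasurable y volume) :
    lorentzENorm ψ (x - y) ≤ lorentzENorm ψ x + lorentzENorm ψ y := by
  rw [sub_eq_add_neg, ← lorentzENorm_neg ψ (x := y)]
  exact lorentzENorm_add_le ψ hx hy.neg

lemma lorentzENorm_sum_le {ι : Type*} (s : Finset ι) (z : ι → I → ℝ)
    (hz : ∀ i ∈ s, AEMeasurable (z i) volume) :
    lorentzENorm ψ (∑ i ∈ s, z i) ≤ ∑ i ∈ s, lorentzENorm ψ (z i) := by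
  classical
  induction s using Finset.induction_on with
  | empty => simp [lorentzENorm_zero]
  | insert a s ha ih =>
    rw [Finset.sum_insert ha, Finset.sum_insert ha]
    have hs : ∀ i ∈ s, AEMeasurable (z i) volume := fun i hi => hz i (Finset.mem_insert_of_mem hi)
    refine (lorentzENorm_add_le ψ (hz a (Finset.mem_insert_self _ _))
      (Finset.aemeasurable_sum s hs)).trans ?_
    gcongr
    exact ih hs

/-- The layer cake formula splits at a level beyond which the function vanishes. -/
lemma lorentzENorm_le_of_bounded (hx : AEMeasurable x volume) {M : ℝ} (hM : ∀ u, |x u| ≤ M) {K : ℝ}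
    (hK : 0 ≤ K) :
    lorentzENorm ψ x ≤ (∫⁻ s in Ioc 0 K, ENNReal.ofReal (ψ (distr x s))) +
      ENNReal.ofReal (M * ψ (distr x K)) := by
  have hM0 : 0 ≤ M := (abs_nonneg _).trans (hM 0)
  rw [lorentzENorm_eq ψ hx, setLIntegral_Ioi_split _ hK]
  gcongr
  have h1 : ∀ s ∈ Ioi K, ENNReal.ofReal (ψ (distr x s)) ≤
      (Ioc 0 M).indicator (fun _ => ENNReal.ofReal (ψ (distr x K))) s := by
    intro s hs
    have hs : K < s := hs
    by_cases hsM : s ≤ M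
    · rw [indicator_of_mem (show s ∈ Ioc 0 M from ⟨hK.trans_lt hs, hsM⟩)]
      exact ψ.mono_distr (distr_nonneg s) (distr_antitone hs.le) (distr_le_one _)
    · have : distr x s = 0 := by
        have : {u : I | s < |x u|} = ∅ :=
          eq_empty_of_forall_notMem fun u (hu : s < |x u|) => hsM (hu.le.trans (hM u))
        rw [distr, this, measureReal_empty]
      rw [this, ψ.map_zero, ENNReal.ofReal_zero]
      exact zero_le
  calc ∫⁻ s in Ioi K, ENNReal.ofReal (ψ (distr x s))
      ≤ ∫⁻ s in Ioi K, (Ioc 0 M).indicator (fun _ => ENNReal.ofReal (ψ (distr x K))) s :=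
        setLIntegral_mono' measurableSet_Ioi h1
    _ ≤ ∫⁻ s, (Ioc 0 M).indicator (fun _ => ENNReal.ofReal (ψ (distr x K))) s :=
        setLIntegral_le_lintegral _ _
    _ = ENNReal.ofReal (M * ψ (distr x K)) := by
        rw [lintegral_indicator measurableSet_Ioc, lintegral_const, Measure.restrict_apply_univ,
          Real.volume_Ioc, sub_zero, mul_comm, ENNReal.ofReal_mul hM0]

lemma lorentzENorm_le_of_abs_le (hx : AEMeasurable x volume) {M : ℝ} (hM : ∀ u, |x u| ≤ M) :
    lorentzENorm ψ x ≤ ENNReal.ofReal (M * ψ 1) := by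
  have hM0 : 0 ≤ M := (abs_nonneg _).trans (hM 0)
  refine (lorentzENorm_le_of_bounded ψ hx hM le_rfl).trans ?_
  simp only [Ioc_self, Measure.restrict_empty, lintegral_zero_measure, zero_add]
  gcongr
  exact ψ.mono (distr_nonneg _) (distr_le_one _) le_rfl

/-- Only the levels below `b` are kept in the layer cake integral. -/
lemma le_lorentzENorm (hx : AEMeasurable x volume) {b t : ℝ} (hb : 0 ≤ b) (ht : 0 ≤ t)
    (h : t ≤ volume.real {u : I | b ≤ |x u|}) : ENNReal.ofReal (b * ψ t) ≤ lorentzENorm ψ x := by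
  rw [lorentzENorm_eq ψ hx]
  have h1 : ∀ s ∈ Ioo 0 b, ENNReal.ofReal (ψ t) ≤ ENNReal.ofReal (ψ (distr x s)) := by
    intro s hs
    refine ψ.mono_distr ht (h.trans (measureReal_mono ?_)) (distr_le_one _)
    exact fun u (hu : b ≤ |x u|) => hs.2.trans_le hu
  calc ENNReal.ofReal (b * ψ t) = ∫⁻ _ in Ioo 0 b, ENNReal.ofReal (ψ t) := by
        rw [lintegral_const, Measure.restrict_apply_univ, Real.volume_Ioo, sub_zero, mul_comm b,
          ENNReal.ofReal_mul' hb]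
    _ ≤ ∫⁻ s in Ioo 0 b, ENNReal.ofReal (ψ (distr x s)) := setLIntegral_mono' measurableSet_Ioo h1
    _ ≤ _ := lintegral_mono_set Ioo_subset_Ioi_self

/-- Concavity gives `t ψ(1) ≤ ψ(t)`, so the layer cake formula compares the norm with that of `L¹`.
-/
lemma lintegral_abs_le_lorentzENorm (hx : AEMeasurable x volume) :
    ENNReal.ofReal (ψ 1) * ∫⁻ u : I, ENNReal.ofReal |x u| ≤ lorentzENorm ψ x := by
  have h := lintegral_Ioi_distr hx (c := 0)
  simp only [sub_zero] at h
  rw [← h, lorentzENorm_eq ψ hx, ← lintegral_const_mul' _ _ ENNReal.ofReal_ne_top]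
  refine lintegral_mono fun s => ?_
  rw [← ENNReal.ofReal_mul ψ.one_pos.le]
  refine ENNReal.ofReal_le_ofReal ?_
  have := ψ.mul_le (distr_nonneg (x := x) s) (distr_le_one s) zero_le_one le_rfl
  rwa [mul_one, mul_comm] at this

lemma integrable_of_lorentzENorm_lt_top (hx : AEMeasurable x volume)
    (h : lorentzENorm ψ x < ∞) : Integrable x volume := by
  refine ⟨hx.aestronglyMeasurable, ?_⟩
  have h1 := (lintegral_abs_le_lorentzENorm ψ hx).trans_lt h
  rw [hasFiniteIntegral_iff_norm]
  simp only [Real.norm_eq_abs]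
  by_contra hc
  rw [not_lt, top_le_iff] at hc
  rw [hc, ENNReal.mul_top (by simpa using ψ.one_pos)] at h1
  exact h1.ne rfl

/-- A constant `a` has norm at most `|a| ψ(1)`, which the `L¹` comparison absorbs. Centring
therefore at most doubles a norm. -/
lemma lorentzENorm_const_integral_le (hx : AEMeasurable x volume) :
    lorentzENorm ψ (fun _ => ∫ u, x u) ≤ lorentzENorm ψ x := by
  refine (lorentzENorm_le_of_abs_le ψ aemeasurable_const fun _ => le_rfl).trans ?_
  refine le_trans ?_ (lintegral_abs_le_lorentzENorm ψ hx)
  rw [mul_comm, ENNReal.ofReal_mul ψ.one_pos.le]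
  gcongr
  rw [← Real.norm_eq_abs, ofReal_norm]
  refine (enorm_integral_le_lintegral_enorm _).trans_eq ?_
  simp_rw [← Real.norm_eq_abs, ofReal_norm]

lemma lorentzENorm_sub_integral_le (hx : AEMeasurable x volume) :
    lorentzENorm ψ (fun u => x u - ∫ v, x v) ≤ 2 * lorentzENorm ψ x := by
  refine (lorentzENorm_sub_le ψ hx aemeasurable_const).trans ?_
  rw [two_mul]
  gcongr
  exact lorentzENorm_const_integral_le ψ hx

/-- The part of a function above a high level has small norm. -/
lemma exists_tail_small (hx : AEMeasurable x volume) (h : lorentzENorm ψ x < ∞) {ε : ℝ≥0∞}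
    (hε : ε ≠ 0) :
    ∃ M₀ : ℝ, 0 ≤ M₀ ∧ ∀ M, M₀ ≤ M → ∀ z : I → ℝ, AEMeasurable z volume →
      (∀ u, |z u| ≤ max (|x u| - M) 0) → lorentzENorm ψ z ≤ ε := by
  set g : ℝ → ℝ≥0∞ := fun s => ENNReal.ofReal (ψ (distr x s)) with hg
  rw [lorentzENorm_eq ψ hx] at h
  have hanti : Antitone (fun n : ℕ => Ioi (n : ℝ)) := fun m n hmn =>
    Ioi_subset_Ioi (by exact_mod_cast hmn)
  have hgm : Antitone g := fun s t hst =>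
    ψ.mono_distr (distr_nonneg _) (distr_antitone hst) (distr_le_one _)
  -- The layer cake integral is a finite measure with density `g`, so its mass on `(n, ∞)` tends to
  -- zero.
  have ht := tendsto_measure_iInter_atTop (μ := volume.withDensity g)
    (fun n : ℕ => (measurableSet_Ioi (a := (n : ℝ))).nullMeasurableSet) hanti
    ⟨0, by rw [withDensity_apply _ measurableSet_Ioi, Nat.cast_zero]; exact h.ne⟩
  have hE : ⋂ n : ℕ, Ioi (n : ℝ) = ∅ := by
    ext u
    simp only [mem_iInter, mem_Ioi, mem_empty_iff_false, iff_false, not_forall, not_lt]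
    exact exists_nat_ge u
  rw [hE, measure_empty] at ht
  obtain ⟨n, hn⟩ := (ht.eventually (gt_mem_nhds hε.bot_lt)).exists
  refine ⟨n, n.cast_nonneg, fun M hM z hz hzx => ?_⟩
  simp only [Function.comp, withDensity_apply _ measurableSet_Ioi] at hn
  refine le_trans ?_ hn.le
  have hM0 : 0 ≤ M := n.cast_nonneg.trans hM
  rw [lorentzENorm_eq ψ hz]
  -- Level `s` of `z` lies inside level `s + M` of `x`; a translation turns the integral for `z`
  -- into the tail of the one for `x`.
  have h3 := (measurePreserving_add_right (volume : Measure ℝ) M).setLIntegral_comp_preimage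
    (s := Ioi M) measurableSet_Ioi (f := g) hgm.measurable
  have h4 : (fun s : ℝ => s + M) ⁻¹' Ioi M = Ioi 0 := by
    ext s
    simp
  rw [h4] at h3
  refine le_trans (setLIntegral_mono' measurableSet_Ioi fun s hs => ?_)
    (h3.le.trans (lintegral_mono_set (Ioi_subset_Ioi hM)))
  refine ψ.mono_distr (distr_nonneg _) (measureReal_mono fun u (hu : s < |z u|) => ?_)
    (distr_le_one _)
  have hs : 0 < s := hs
  have h5 := hu.trans_le (hzx u)
  rcases lt_max_iff.1 h5 with h6 | h6
  · change s + M < |x u|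
    linarith
  · linarith

/-- Lower Riemann sums of the layer cake integral. -/
lemma sum_le_lorentzENorm (hx : AEMeasurable x volume) {h : ℝ} (hh : 0 < h) (J : ℕ) :
    ∑ j ∈ Finset.range J, ENNReal.ofReal (h * ψ (distr x ((j + 1) * h))) ≤ lorentzENorm ψ x := by
  have key : ∑ j ∈ Finset.range J, ENNReal.ofReal (h * ψ (distr x ((j + 1) * h))) ≤
      ∫⁻ s in Ioc 0 (J * h), ENNReal.ofReal (ψ (distr x s)) := by
    induction J with
    | zero => simp
    | succ J ih =>
      rw [Finset.sum_range_succ]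
      have hJ : (0 : ℝ) ≤ J * h := by positivity
      have hJ' : (J : ℝ) * h ≤ (J + 1 : ℕ) * h := by push_cast; linarith
      rw [← Ioc_union_Ioc_eq_Ioc hJ hJ', lintegral_union measurableSet_Ioc
        (Ioc_disjoint_Ioc_of_le le_rfl)]
      refine add_le_add ih ?_
      have h1 : ∫⁻ _ in Ioc ((J : ℝ) * h) ((J + 1 : ℕ) * h),
          ENNReal.ofReal (ψ (distr x ((J + 1) * h))) =
          ENNReal.ofReal (h * ψ (distr x ((J + 1) * h))) := by
        rw [lintegral_const, Measure.restrict_apply_univ, Real.volume_Ioc, mul_comm h,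
          ENNReal.ofReal_mul' hh.le]
        congr 2
        push_cast
        ring
      rw [← h1]
      refine setLIntegral_mono' measurableSet_Ioc fun s hs => ?_
      refine ψ.mono_distr (distr_nonneg _) (distr_antitone ?_) (distr_le_one _)
      exact_mod_cast hs.2
  rw [lorentzENorm_eq ψ hx]
  exact key.trans (lintegral_mono_set Ioc_subset_Ioi_self)

end Functional

/-! ### Sums of bounded independent random variables -/

section Tails

variable {Y : ℕ → I → ℝ}

lemma memLp_of_abs_le {y : I → ℝ} (hy : Measurable y) {M : ℝ} (hM : ∀ ω, |y ω| ≤ M) (p : ℝ≥0∞) :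
    MemLp y p volume :=
  MemLp.of_bound hy.aestronglyMeasurable M (Eventually.of_forall hM)

lemma integrable_of_abs_le {y : I → ℝ} (hy : Measurable y) {M : ℝ} (hM : ∀ ω, |y ω| ≤ M) :
    Integrable y volume :=
  memLp_one_iff_integrable.1 (memLp_of_abs_le hy hM 1)

/-- Chebyshev's inequality for sums of independent centred bounded random variables. -/
lemma measureReal_abs_sum_ge_le_sq (hind : iIndepFun Y volume) (hY : ∀ i, Measurable (Y i)) {M : ℝ}
    (hM : ∀ i ω, |Y i ω| ≤ M) (h0 : ∀ i, ∫ ω, Y i ω = 0) {v : ℝ} (hv : ∀ i, ∫ ω, Y i ω ^ 2 ≤ v)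
    (N : ℕ) {s : ℝ} (hs : 0 < s) :
    volume.real {ω : I | s ≤ |∑ i ∈ Finset.range N, Y i ω|} ≤ N * v / s ^ 2 := by
  have hLp : ∀ i ∈ Finset.range N, MemLp (Y i) 2 volume := fun i _ => memLp_of_abs_le (hY i) (hM i) 2
  have hint : ∀ i ∈ Finset.range N, Integrable (Y i) volume :=
    fun i _ => integrable_of_abs_le (hY i) (hM i)
  have hmean : ∫ ω, (∑ i ∈ Finset.range N, Y i) ω = 0 := by
    simp only [Finset.sum_apply]
    rw [integral_finsetSum _ hint]
    simp [h0]
  have hvar : variance (∑ i ∈ Finset.range N, Y i) volume ≤ N * v := by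
    rw [IndepFun.variance_sum hLp fun i _ j _ hij => hind.indepFun hij]
    refine (Finset.sum_le_sum fun i _ => ?_).trans_eq (by simp : ∑ i ∈ Finset.range N, v = N * v)
    rw [variance_of_integral_eq_zero (hY i).aemeasurable (h0 i)]
    exact hv i
  have hc := meas_ge_le_variance_div_sq (memLp_finsetSum' (Finset.range N) hLp) hs
  rw [hmean] at hc
  simp only [sub_zero, Finset.sum_apply] at hc
  refine (ENNReal.toReal_le_of_le_ofReal (div_nonneg (variance_nonneg _ _) (by positivity)) hc).trans ?_
  gcongr

/-- Markov's inequality for sums of bounded random variables. -/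
lemma measureReal_abs_sum_ge_le (hY : ∀ i, Measurable (Y i)) {M : ℝ} (hM : ∀ i ω, |Y i ω| ≤ M)
    {v : ℝ} (hv : ∀ i, ∫ ω, |Y i ω| ≤ v) (N : ℕ) {s : ℝ} (hs : 0 < s) :
    volume.real {ω : I | s ≤ |∑ i ∈ Finset.range N, Y i ω|} ≤ N * v / s := by
  have hint : ∀ i, Integrable (Y i) volume := fun i => integrable_of_abs_le (hY i) (hM i)
  have hint' : Integrable (fun ω => ∑ i ∈ Finset.range N, Y i ω) volume :=
    integrable_finsetSum _ fun i _ => hint i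
  have h1 := mul_meas_ge_le_integral_of_nonneg (μ := volume)
    (f := fun ω : I => |∑ i ∈ Finset.range N, Y i ω|) (Eventually.of_forall fun _ => abs_nonneg _)
    hint'.abs s
  rw [le_div_iff₀ hs, mul_comm]
  refine h1.trans ?_
  calc ∫ ω, |∑ i ∈ Finset.range N, Y i ω| ≤ ∫ ω, ∑ i ∈ Finset.range N, |Y i ω| :=
        integral_mono hint'.abs (integrable_finsetSum _ fun i _ => (hint i).abs)
          fun ω => Finset.abs_sum_le_sum_abs _ _
    _ = ∑ i ∈ Finset.range N, ∫ ω, |Y i ω| := integral_finsetSum _ fun i _ => (hint i).abs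
    _ ≤ ∑ i ∈ Finset.range N, v := Finset.sum_le_sum fun i _ => hv i
    _ = N * v := by simp

end Tails

/-! ### Centred sums of independent indicators -/

section Indicators

variable {b : ℕ → I → ℝ} {u : ℝ}

/-- A sequence of independent indicator functions with mean `u`. -/
structure IsBernoulliSeq (b : ℕ → I → ℝ) (u : ℝ) : Prop where
  indep : iIndepFun b volume
  measurable : ∀ i, Measurable (b i)
  zero_or_one : ∀ i ω, b i ω = 0 ∨ b i ω = 1
  mean : ∀ i, ∫ ω, b i ω = u

namespace IsBernoulliSeq

variable (hb : IsBernoulliSeq b u)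
include hb

lemma nonneg (i : ℕ) (ω : I) : 0 ≤ b i ω := by
  rcases hb.zero_or_one i ω with h | h <;> simp [h]

lemma le_one (i : ℕ) (ω : I) : b i ω ≤ 1 := by
  rcases hb.zero_or_one i ω with h | h <;> simp [h]

lemma integrable (i : ℕ) : Integrable (b i) volume :=
  integrable_of_abs_le (M := 1) (hb.measurable i)
    fun ω => abs_le.2 ⟨by linarith [hb.nonneg i ω], hb.le_one i ω⟩

lemma mean_nonneg : 0 ≤ u := hb.mean 0 ▸ integral_nonneg (hb.nonneg 0)

lemma mean_le_one : u ≤ 1 := by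
  rw [← hb.mean 0]
  refine (integral_mono (hb.integrable 0) (integrable_const 1) (hb.le_one 0)).trans_eq ?_
  simp

lemma abs_sub_le_one (i : ℕ) (ω : I) : |b i ω - u| ≤ 1 :=
  abs_le.2 ⟨by linarith [hb.nonneg i ω, hb.mean_le_one], by linarith [hb.le_one i ω, hb.mean_nonneg]⟩

lemma measurable_sub (i : ℕ) : Measurable fun ω => b i ω - u := (hb.measurable i).sub_const u

lemma indep_sub : iIndepFun (fun i ω => b i ω - u) volume :=
  hb.indep.comp (fun _ x => x - u) fun _ => measurable_id.sub_const u

lemma integral_sub_eq_zero (i : ℕ) : ∫ ω, (b i ω - u) = 0 := by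
  rw [integral_sub (hb.integrable i) (integrable_const u), hb.mean i]
  simp

lemma abs_sum_le (N : ℕ) (ω : I) : |∑ i ∈ Finset.range N, (b i ω - u)| ≤ N :=
  (Finset.abs_sum_le_sum_abs _ _).trans
    ((Finset.sum_le_sum fun i _ => hb.abs_sub_le_one i ω).trans_eq (by simp))

lemma distr_le_chebyshev (N : ℕ) {s : ℝ} (hs : 0 < s) :
    distr (fun ω => ∑ i ∈ Finset.range N, (b i ω - u)) s ≤ N * u / s ^ 2 := by
  refine (measureReal_mono fun ω (hω : s < _) => hω.le).trans
    (measureReal_abs_sum_ge_le_sq hb.indep_sub hb.measurable_sub hb.abs_sub_le_one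
      hb.integral_sub_eq_zero (fun i => ?_) N hs)
  -- Since `b² = b`, the square is affine in `b`, and the variance is `u - u² ≤ u`.
  have h1 : ∀ ω, (b i ω - u) ^ 2 = (1 - 2 * u) * b i ω + u ^ 2 := by
    intro ω
    rcases hb.zero_or_one i ω with h | h <;> rw [h] <;> ring
  simp_rw [h1]
  rw [integral_add ((hb.integrable i).const_mul _) (integrable_const _), integral_const_mul,
    hb.mean i]
  simp
  nlinarith [sq_nonneg u]

lemma distr_le_markov (N : ℕ) {s : ℝ} (hs : 0 < s) :
    distr (fun ω => ∑ i ∈ Finset.range N, (b i ω - u)) s ≤ N * (2 * u) / s := by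
  refine (measureReal_mono fun ω (hω : s < _) => hω.le).trans
    (measureReal_abs_sum_ge_le hb.measurable_sub hb.abs_sub_le_one (fun i => ?_) N hs)
  have h1 : ∀ ω, |b i ω - u| ≤ b i ω + u := fun ω =>
    abs_le.2 ⟨by linarith [hb.nonneg i ω], by linarith [hb.mean_nonneg]⟩
  refine (integral_mono (integrable_of_abs_le (hb.measurable_sub i) (hb.abs_sub_le_one i)).abs
    ((hb.integrable i).add (integrable_const u)) h1).trans_eq ?_
  simp only [Pi.add_apply]
  rw [integral_add (hb.integrable i) (integrable_const u), hb.mean i]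
  simp
  ring

/-- Markov is used for `s ≤ 1`, where `s^q ≤ s`, and Chebyshev for `s ≥ 1`, where `s^q ≤ s²`. The
bound stays linear in `u`, and `q` can be taken so close to `1` that its power `α` is integrable in
`s` near zero, which `s^(-2α)` need not be. -/
lemma distr_le_interpolated (N : ℕ) {s q : ℝ} (hs : 0 < s) (hq1 : 1 ≤ q) (hq2 : q ≤ 2) :
    distr (fun ω => ∑ i ∈ Finset.range N, (b i ω - u)) s ≤ 2 * N / s ^ q * u := by
  have hu := hb.mean_nonneg
  rcases le_total s 1 with h | h
  · have h1 : s ^ q ≤ s := Real.rpow_le_self_of_le_one hs.le h hq1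
    refine (hb.distr_le_markov N hs).trans ?_
    rw [show (N : ℝ) * (2 * u) / s = 2 * N / s * u by ring]
    gcongr
  · have h1 : s ^ q ≤ s ^ 2 := by
      rw [← Real.rpow_natCast]
      exact Real.rpow_le_rpow_of_exponent_le h (by exact_mod_cast hq2)
    refine (hb.distr_le_chebyshev N hs).trans ?_
    have h2 : (N : ℝ) * u / s ^ 2 ≤ N * u / s ^ q := by gcongr
    have h3 : 0 ≤ (N : ℝ) * u / s ^ q := by positivity
    calc (N : ℝ) * u / s ^ 2 ≤ 2 * (N * u / s ^ q) := by linarith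
      _ = _ := by ring

lemma distr_le_hoeffding {N : ℕ} {s : ℝ} (hs : 0 ≤ s) :
    distr (fun ω => ∑ i ∈ Finset.range N, (b i ω - u)) s ≤ 2 * Real.exp (-2 * s ^ 2 / N) := by
  have hsub : ∀ i, HasSubgaussianMGF (fun ω => b i ω - u) ((‖(1 : ℝ) - 0‖₊ / 2) ^ 2) volume := by
    intro i
    have := hasSubgaussianMGF_of_mem_Icc (μ := volume) (hb.measurable i).aemeasurable
      (Eventually.of_forall fun ω => (⟨hb.nonneg i ω, hb.le_one i ω⟩ : b i ω ∈ Icc (0 : ℝ) 1))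
    rwa [hb.mean i] at this
  have hsub' : ∀ i, HasSubgaussianMGF (fun ω => -(b i ω - u)) ((‖(1 : ℝ) - 0‖₊ / 2) ^ 2) volume :=
    fun i => (hsub i).neg
  have h1 := HasSubgaussianMGF.measure_sum_range_ge_le_of_iIndepFun hb.indep_sub (n := N)
    (fun i _ => hsub i) hs
  have h2 := HasSubgaussianMGF.measure_sum_range_ge_le_of_iIndepFun
    (hb.indep_sub.comp (fun _ x => -x) fun _ => measurable_neg) (n := N)
    (fun i _ => hsub' i) hs
  have he : -s ^ 2 / (2 * N * (((‖(1 : ℝ) - 0‖₊ / 2) ^ 2 : NNReal) : ℝ)) = -2 * s ^ 2 / N := by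
    simp
    field_simp
  rw [he] at h1 h2
  calc distr (fun ω => ∑ i ∈ Finset.range N, (b i ω - u)) s
      ≤ volume.real ({ω : I | s ≤ ∑ i ∈ Finset.range N, (b i ω - u)} ∪
          {ω : I | s ≤ ∑ i ∈ Finset.range N, -(b i ω - u)}) := by
        refine measureReal_mono fun ω (hω : s < _) => ?_
        rcases lt_abs.1 hω with h | h
        · exact Or.inl h.le
        · refine Or.inr ?_
          change s ≤ ∑ i ∈ Finset.range N, -(b i ω - u)
          rw [Finset.sum_neg_distrib]
          exact h.le
    _ ≤ _ := measureReal_union_le _ _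
    _ ≤ _ := by
      rw [two_mul]
      exact add_le_add h1 h2

/-- Exponential Markov with `e^θ = u^(-1/2)`: each factor of the moment generating function is at
most `1 + √u ≤ e^(√u)`, so `N √u ≤ 1` bounds the product by `e ≤ 3`, while `e^(-θs) = u^(s/2)`. -/
lemma distr_le_chernoff {N : ℕ} (hu : 0 < u) (huN : N * √u ≤ 1) {s : ℝ} (hs : N * u ≤ s) :
    distr (fun ω => ∑ i ∈ Finset.range N, (b i ω - u)) s ≤ 3 * u ^ (s / 2) := by
  have hu1 := hb.mean_le_one
  set θ := -Real.log u / 2 with hθ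
  have hθ0 : 0 ≤ θ := by
    have := Real.log_nonpos hu.le hu1
    rw [hθ]
    linarith
  have hexp : ∀ i ω, Real.exp (θ * b i ω) = 1 + (Real.exp θ - 1) * b i ω := by
    intro i ω
    rcases hb.zero_or_one i ω with h | h <;> simp [h]
  have hmgf : ∀ i, mgf (b i) volume θ ≤ Real.exp (√u) := by
    intro i
    have h1 : mgf (b i) volume θ = 1 + (Real.exp θ - 1) * u := by
      rw [mgf]
      simp_rw [hexp i]
      rw [integral_add (integrable_const _) ((hb.integrable i).const_mul _), integral_const_mul,
        hb.mean i]
      simp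
    have h2 : Real.exp θ * u = √u := by
      calc Real.exp θ * u = Real.exp θ * Real.exp (Real.log u) := by rw [Real.exp_log hu]
        _ = √u := by
          rw [Real.sqrt_eq_rpow, Real.rpow_def_of_pos hu, ← Real.exp_add, hθ]
          congr 1
          ring
    rw [h1, sub_mul, h2]
    refine le_trans ?_ (Real.add_one_le_exp _)
    linarith
  have hsum : mgf (∑ i ∈ Finset.range N, b i) volume θ ≤ 3 := by
    rw [hb.indep.mgf_sum hb.measurable]
    calc ∏ i ∈ Finset.range N, mgf (b i) volume θ ≤ ∏ _i ∈ Finset.range N, Real.exp (√u) :=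
          Finset.prod_le_prod (fun i _ => mgf_nonneg) fun i _ => hmgf i
      _ = Real.exp (N * √u) := by
          rw [Finset.prod_const, Finset.card_range, ← Real.exp_nat_mul]
      _ ≤ Real.exp 1 := Real.exp_le_exp.2 huN
      _ ≤ 3 := Real.exp_one_lt_d9.le.trans (by norm_num)
  have hint : Integrable (fun ω => Real.exp (θ * (∑ i ∈ Finset.range N, b i) ω)) volume :=
    hb.indep.integrable_exp_mul_sum hb.measurable fun i _ => by
      simp_rw [hexp i]
      exact (integrable_const _).add ((hb.integrable i).const_mul _)
  have hch := measure_ge_le_exp_mul_mgf s hθ0 hint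
  calc distr (fun ω => ∑ i ∈ Finset.range N, (b i ω - u)) s
      ≤ volume.real {ω : I | s ≤ (∑ i ∈ Finset.range N, b i) ω} := by
        refine measureReal_mono fun ω (hω : s < _) => ?_
        change s ≤ (∑ i ∈ Finset.range N, b i) ω
        change s < |∑ i ∈ Finset.range N, (b i ω - u)| at hω
        rw [Finset.sum_sub_distrib, Finset.sum_const, Finset.card_range, nsmul_eq_mul] at hω
        rw [Finset.sum_apply]
        have hB : 0 ≤ ∑ i ∈ Finset.range N, b i ω := Finset.sum_nonneg fun i _ => hb.nonneg i ω
        have hNu : 0 ≤ N * u := by positivity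
        -- A deviation below the mean cannot exceed `N u ≤ s`, so only the upper tail remains.
        rcases lt_abs.1 hω with h | h <;> linarith
    _ ≤ Real.exp (-θ * s) * mgf (∑ i ∈ Finset.range N, b i) volume θ := hch
    _ ≤ Real.exp (-θ * s) * 3 := by gcongr
    _ = 3 * u ^ (s / 2) := by
      rw [mul_comm, Real.rpow_def_of_pos hu, hθ]
      ring_nf

/-- At level `N ^ (1 / q)`, `q < 2`, the deviation probability is a high power of `u`. -/
lemma distr_le_rpow {N : ℕ} {q ε : ℝ} (hq1 : 1 < q) (hq2 : q < 2) (hε : ε = 1 / q - 1 / 2)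
    (hT : 1 ≤ ε * (N : ℝ) ^ ε) (hu : 0 < u) :
    distr (fun ω => ∑ i ∈ Finset.range N, (b i ω - u)) ((N : ℝ) ^ (1 / q)) ≤
      3 * (min u (1 / 2)) ^ (ε * (N : ℝ) ^ ε) := by
  have hq0 : 0 < q := by linarith
  have hqi1 : 1 / q < 1 := (div_lt_one hq0).2 hq1
  have hqi2 : 1 / 2 < 1 / q := one_div_lt_one_div_of_lt hq0 hq2
  have hε0 : 0 < ε := by linarith
  have hε2 : ε < 1 / 2 := by linarith
  have hN : 2 ≤ N := by
    by_contra! hc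
    have : (N : ℝ) ^ ε ≤ 1 :=
      Real.rpow_le_one (by positivity) (by exact_mod_cast (by omega : N ≤ 1)) hε0.le
    nlinarith
  have hN2 : (2 : ℝ) ≤ N := by exact_mod_cast hN
  have hN1 : (1 : ℝ) ≤ N := by linarith
  have hN0 : (0 : ℝ) < N := by linarith
  set T := ε * (N : ℝ) ^ ε with hTdef
  set K := (N : ℝ) ^ (1 / q) with hK
  have hK1 : 1 ≤ K := Real.one_le_rpow hN1 (by linarith)
  -- The cap at `1/2` handles `u` near `1`, where powers of `u` do not decay, and matches the range
  -- of `exists_power_bound`.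
  set v := min u (1 / 2) with hv
  have hv0 : 0 < v := lt_min hu (by norm_num)
  -- For `u ≥ N^(-2)`, `-log v` is at most `2 log N`, and the Hoeffding exponent `2K²/N = 2N^(2ε)`
  -- beats `T · 2 log N`. For smaller `u`, `N √u ≤ 1` and the Chernoff bound applies with `T ≤ K/2`.
  rcases le_or_gt (1 / (N : ℝ) ^ 2) u with h | h
  · have hvN : 1 / (N : ℝ) ^ 2 ≤ v := by
      refine le_min h ?_
      gcongr
      nlinarith
    have hlog : -Real.log v ≤ 2 * Real.log N := by
      have := Real.log_le_log (by positivity) hvN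
      rw [one_div, Real.log_inv, Real.log_pow] at this
      push_cast at this
      linarith
    have hKN : K ^ 2 / N = (N : ℝ) ^ ε * (N : ℝ) ^ ε := by
      rw [hK, ← Real.rpow_add hN0, ← Real.rpow_natCast, ← Real.rpow_mul hN0.le, div_eq_iff hN0.ne',
        ← Real.rpow_add_one hN0.ne', hε]
      congr 1
      push_cast
      ring
    have hlogN : ε * Real.log N ≤ (N : ℝ) ^ ε := by
      have := Real.log_le_rpow_div hN0.le hε0
      rw [le_div_iff₀ hε0] at this
      linarith
    have hle : Real.exp (-2 * K ^ 2 / N) ≤ v ^ T := by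
      rw [Real.rpow_def_of_pos hv0]
      refine Real.exp_le_exp.2 ?_
      rw [mul_div_assoc, hKN]
      have hNε : 0 ≤ (N : ℝ) ^ ε := by positivity
      have h1 : -Real.log v * T ≤ 2 * Real.log N * T := by gcongr
      have h2 : 2 * Real.log N * T ≤ 2 * ((N : ℝ) ^ ε * (N : ℝ) ^ ε) := by
        rw [hTdef]
        nlinarith [mul_le_mul_of_nonneg_right hlogN hNε]
      linarith
    have := hb.distr_le_hoeffding (N := N) (s := K) (by linarith)
    have h3 : 0 ≤ v ^ T := by positivity
    linarith
  · have hsq : √u ≤ 1 / N := by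
      refine Real.sqrt_le_iff.2 ⟨by positivity, ?_⟩
      rw [div_pow, one_pow]
      exact h.le
    have hNs : N * √u ≤ 1 := by
      have := mul_le_mul_of_nonneg_left hsq hN0.le
      rwa [mul_one_div_cancel hN0.ne'] at this
    have hu4 : u ≤ 1 / 2 := h.le.trans (by gcongr; nlinarith)
    have hNu : N * u ≤ K := by
      refine le_trans ?_ hK1
      have h1 : u ≤ √u := Real.le_sqrt_of_sq_le (by nlinarith)
      nlinarith
    have hTK : T ≤ K / 2 := by
      have h1 : (N : ℝ) ^ ε ≤ K := Real.rpow_le_rpow_of_exponent_le hN1 (by linarith)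
      have h2 : 0 ≤ (N : ℝ) ^ ε := by positivity
      rw [hTdef]
      nlinarith
    have hvu : v = u := min_eq_left hu4
    rw [hvu]
    refine (hb.distr_le_chernoff hu hNs hNu).trans ?_
    gcongr 3 * ?_
    exact Real.rpow_le_rpow_of_exponent_ge hu (by linarith) hTK

end IsBernoulliSeq

end Indicators

/-! ### Sublinear norm bound for centred sums of indicators. -/

section BernoulliNorm

variable (ψ : LorentzWeight)

lemma LorentzWeight.min_one_mul_le {c x : ℝ} (hc : 1 ≤ c) (hx : 0 ≤ x) (hx1 : x ≤ 1) :
    ψ (min 1 (c * x)) ≤ c * ψ x := by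
  have hc0 : 0 < c := by linarith
  rcases le_total (c * x) 1 with h | h
  · rw [min_eq_right h]
    exact ψ.le_mul hc hx h
  · rw [min_eq_left h]
    have h1 : c⁻¹ * ψ 1 ≤ ψ (c⁻¹ * 1) :=
      ψ.mul_le (inv_nonneg.2 hc0.le) (inv_le_one_of_one_le₀ hc) zero_le_one le_rfl
    have h2 : ψ (c⁻¹ * 1) ≤ ψ x :=
      ψ.mono (by positivity) (by rw [mul_one]; exact (inv_le_iff_one_le_mul₀' hc0).2 h) hx1
    have h3 := h1.trans h2
    rwa [inv_mul_le_iff₀ hc0] at h3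

lemma lintegral_Ioc_rpow_neg {a K c : ℝ} (ha : a < 1) (hK : 0 ≤ K) (hc : 0 ≤ c) :
    ∫⁻ s in Ioc 0 K, ENNReal.ofReal (c * s ^ (-a)) =
      ENNReal.ofReal (c * (K ^ (1 - a) / (1 - a))) := by
  have hint : IntervalIntegrable (fun s : ℝ => s ^ (-a)) volume 0 K :=
    intervalIntegral.intervalIntegrable_rpow' (by linarith)
  have hint' : IntegrableOn (fun s : ℝ => s ^ (-a)) (Ioc 0 K) :=
    (intervalIntegrable_iff_integrableOn_Ioc_of_le hK).1 hint
  rw [← ofReal_integral_eq_lintegral_ofReal (hint'.const_mul c)]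
  · rw [integral_const_mul, ← intervalIntegral.integral_of_le hK,
      integral_rpow (Or.inl (by linarith)), Real.zero_rpow (by linarith)]
    congr 3
    · ring_nf
    · ring
  · filter_upwards [ae_restrict_mem measurableSet_Ioc] with s hs
    have := hs.1
    change 0 ≤ c * s ^ (-a)
    positivity

/-- Centred sums of `N` independent indicators of sets of measure `u` have norm at most
`C * N ^ r * ψ u`. -/
def HasBernoulliBound (r C : ℝ) : Prop :=
  ∀ (b : ℕ → I → ℝ) (u : ℝ), IsBernoulliSeq b u →
    ∀ N : ℕ, 1 ≤ N → lorentzENorm ψ (fun ω => ∑ i ∈ Finset.range N, (b i ω - u)) ≤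
      ENNReal.ofReal (C * (N : ℝ) ^ r * ψ u)

/-- If both limit conditions hold, centred sums of independent indicators grow sublinearly. -/
lemma exists_bernoulli_bound
    (hk : ∃ k : ℕ, 2 ≤ k ∧ limsup (fun u : ℝ => ψ (k * u) / ψ u) (𝓝[>] 0) < k)
    (hl : ∃ l : ℕ, 2 ≤ l ∧ limsup (fun u : ℝ => ψ (u ^ l) / ψ u) (𝓝[>] 0) < 1) :
    ∃ r C : ℝ, 0 < r ∧ r < 1 ∧ 0 ≤ C ∧ HasBernoulliBound ψ r C := by
  obtain ⟨k, hk2, hk⟩ := hk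
  obtain ⟨l, hl2, hl⟩ := hl
  obtain ⟨α, C₁, hα0, hα1, hC₁, hdil⟩ := exists_dilation_bound ψ hk2 hk
  obtain ⟨β, C₂, hβ0, hC₂, hpow⟩ := exists_power_bound ψ hl2 hl
  -- `q < 2` puts the cut `N^(1/q)` above the Gaussian scale `√N`, and `q α < 1` makes `s^(-qα)`
  -- integrable at zero.
  obtain ⟨q, hq1, hq'⟩ := exists_between (lt_min ((one_lt_div hα0).2 hα1) (by norm_num : (1 : ℝ) < 2))
  have hq2 : q < 2 := hq'.trans_le (min_le_right _ _)
  have hqα : q * α < 1 := (lt_div_iff₀ hα0).1 (hq'.trans_le (min_le_left _ _))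
  have hq0 : 0 < q := by linarith
  have hqi1 : 1 / q < 1 := (div_lt_one hq0).2 hq1
  have hqi2 : 1 / 2 < 1 / q := one_div_lt_one_div_of_lt hq0 hq2
  obtain ⟨ε, hε⟩ : ∃ ε, ε = 1 / q - 1 / 2 := ⟨_, rfl⟩
  have hε0 : 0 < ε := by linarith
  -- The first exponent comes from levels below the cut; the second from levels above it, at most
  -- `N` in length, where `ψ` of the tail has gained `N^(-εβ)`.
  set r := max (1 / q) (1 - ε * β) with hr
  set A := C₁ * 2 ^ α / (1 - q * α) with hA
  set B := (3 * C₂ + 2) * ε ^ (-β) with hB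
  have hqα' : 0 < 1 - q * α := by linarith
  have hA0 : 0 ≤ A := by positivity
  have hB0 : 0 ≤ B := by positivity
  refine ⟨r, A + B, (by positivity : (0 : ℝ) < 1 / q).trans_le (le_max_left _ _),
    max_lt hqi1 (by linarith [mul_pos hε0 hβ0]), by positivity, ?_⟩
  intro b u hb N hN
  have hN1 : (1 : ℝ) ≤ N := by exact_mod_cast hN
  have hN0 : (0 : ℝ) < N := by linarith
  set D : I → ℝ := fun ω => ∑ i ∈ Finset.range N, (b i ω - u) with hD
  have hDm : Measurable D := Finset.measurable_sum _ fun i _ => hb.measurable_sub i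
  -- For `u = 0` the right side vanishes, and so does the sum almost everywhere.
  rcases hb.mean_nonneg.eq_or_lt with hu | hu
  · have h0 : D =ᵐ[volume] 0 := by
      have h1 : ∀ i, b i =ᵐ[volume] 0 := fun i =>
        (integral_eq_zero_iff_of_nonneg (hb.nonneg i) (hb.integrable i)).1 ((hb.mean i).trans hu.symm)
      filter_upwards [ae_all_iff.2 h1] with ω hω
      simp [hD, hω, ← hu]
    rw [lorentzENorm_congr ψ h0, lorentzENorm_zero]
    exact zero_le
  have hu1 := hb.mean_le_one
  have hψu := ψ.pos hu hu1
  set K := (N : ℝ) ^ (1 / q) with hK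
  have hK1 : 1 ≤ K := Real.one_le_rpow hN1 (by linarith)
  have hK0 : 0 < K := by linarith
  have hKq : K ^ q = N := by
    rw [hK, ← Real.rpow_mul hN0.le, one_div_mul_cancel hq0.ne', Real.rpow_one]
  have hlow : ∫⁻ s in Ioc 0 K, ENNReal.ofReal (ψ (distr D s)) ≤
      ENNReal.ofReal (A * (N : ℝ) ^ (1 / q) * ψ u) := by
    calc ∫⁻ s in Ioc 0 K, ENNReal.ofReal (ψ (distr D s))
        ≤ ∫⁻ s in Ioc 0 K, ENNReal.ofReal ((C₁ * (2 * N) ^ α * ψ u) * s ^ (-(q * α))) := by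
          refine setLIntegral_mono' measurableSet_Ioc fun s hs => ENNReal.ofReal_le_ofReal ?_
          have hs0 := hs.1
          have hsq : s ^ q ≤ N := by
            rw [← hKq]
            exact Real.rpow_le_rpow hs0.le hs.2 hq0.le
          have ht : 1 ≤ 2 * N / s ^ q := by
            rw [one_le_div (by positivity)]
            linarith
          have h1 : distr D s ≤ min 1 (2 * N / s ^ q * u) :=
            le_min (distr_le_one s) (hb.distr_le_interpolated N hs0 hq1.le hq2.le)
          refine (ψ.mono (distr_nonneg s) h1 (min_le_left _ _)).trans
            ((hdil _ u ht hu hu1).trans_eq ?_)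
          rw [Real.div_rpow (by positivity) (by positivity), ← Real.rpow_mul hs0.le,
            Real.rpow_neg hs0.le]
          ring
      _ = ENNReal.ofReal ((C₁ * (2 * N) ^ α * ψ u) * (K ^ (1 - q * α) / (1 - q * α))) :=
          lintegral_Ioc_rpow_neg hqα hK0.le (by positivity)
      _ = ENNReal.ofReal (A * (N : ℝ) ^ (1 / q) * ψ u) := by
          congr 1
          have h1 : (N : ℝ) ^ (1 / q) = (N : ℝ) ^ α * K ^ (1 - q * α) := by
            rw [hK, ← Real.rpow_mul hN0.le, ← Real.rpow_add hN0]
            congr 1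
            field_simp
            ring
          rw [h1, Real.mul_rpow (by norm_num) hN0.le, hA]
          ring
  have hhigh : ψ (distr D K) ≤ (3 * C₂ + 2) * (ε * (N : ℝ) ^ ε) ^ (-β) * ψ u := by
    set T := ε * (N : ℝ) ^ ε with hT
    have hT0 : 0 < T := by positivity
    have hTβ : 0 < T ^ (-β) := by positivity
    -- For `T < 1` no decay is needed: `T^(-β) ≥ 1`, and the moment bound at `K`, where `K^q = N`,
    -- reads `2u`. The constant `3 C₂ + 2` serves both cases.
    rcases le_or_gt 1 T with h | h
    · have hv0 : 0 < min u (1 / 2) := lt_min hu (by norm_num)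
      have hv2 : min u (1 / 2) ≤ 1 / 2 := min_le_right _ _
      have hv1 : (min u (1 / 2)) ^ T ≤ 1 :=
        Real.rpow_le_one hv0.le (by linarith) hT0.le
      have h1 : distr D K ≤ min 1 (3 * (min u (1 / 2)) ^ T) :=
        le_min (distr_le_one _) (hb.distr_le_rpow hq1 hq2 hε h hu)
      calc ψ (distr D K) ≤ ψ (min 1 (3 * (min u (1 / 2)) ^ T)) :=
            ψ.mono (distr_nonneg _) h1 (min_le_left _ _)
        _ ≤ 3 * ψ ((min u (1 / 2)) ^ T) := ψ.min_one_mul_le (by norm_num) (by positivity) hv1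
        _ ≤ 3 * (C₂ * T ^ (-β) * ψ (min u (1 / 2))) := by
            gcongr
            exact hpow _ _ h hv0 hv2
        _ ≤ 3 * (C₂ * T ^ (-β) * ψ u) := by
            gcongr
            exact ψ.mono hv0.le (min_le_left _ _) hu1
        _ ≤ (3 * C₂ + 2) * T ^ (-β) * ψ u := by nlinarith [mul_pos hTβ hψu]
    · have h1 : distr D K ≤ min 1 (2 * u) := by
        refine le_min (distr_le_one _) ((hb.distr_le_interpolated N hK0 hq1.le hq2.le).trans_eq ?_)
        rw [hKq]
        field_simp
      have h2 : 1 ≤ T ^ (-β) :=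
        Real.one_le_rpow_of_pos_of_le_one_of_nonpos hT0 h.le (by linarith)
      calc ψ (distr D K) ≤ ψ (min 1 (2 * u)) := ψ.mono (distr_nonneg _) h1 (min_le_left _ _)
        _ ≤ 2 * ψ u := ψ.min_one_mul_le (by norm_num) hu.le hu1
        _ ≤ (3 * C₂ + 2) * T ^ (-β) * ψ u := by
            gcongr
            nlinarith [mul_pos hC₂ hTβ]
  have hNβ : (N : ℝ) * ψ (distr D K) ≤ B * (N : ℝ) ^ (1 - ε * β) * ψ u := by
    calc (N : ℝ) * ψ (distr D K) ≤ N * ((3 * C₂ + 2) * (ε * (N : ℝ) ^ ε) ^ (-β) * ψ u) := by gcongr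
      _ = B * (N : ℝ) ^ (1 - ε * β) * ψ u := by
        rw [Real.mul_rpow hε0.le (by positivity), ← Real.rpow_mul hN0.le,
          sub_eq_add_neg, Real.rpow_add hN0, Real.rpow_one, hB]
        ring_nf
  have hsplit := lorentzENorm_le_of_bounded ψ hDm.aemeasurable (hb.abs_sum_le N) hK0.le
  refine hsplit.trans ((add_le_add hlow (ENNReal.ofReal_le_ofReal hNβ)).trans ?_)
  rw [← ENNReal.ofReal_add (by positivity) (by positivity), add_mul, add_mul]
  gcongr
  · exact le_max_left _ _
  · exact le_max_right _ _

end BernoulliNorm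

/-! ### Sums of independent identically distributed functions -/

/-- Measurable, independent and identically distributed functions on `[0,1]`. -/
structure IsIIDSeq (X : ℕ → I → ℝ) : Prop where
  indep : iIndepFun X volume
  measurable : ∀ i, Measurable (X i)
  ident : ∀ i, IdentDistrib (X i) (X 0) volume volume

namespace IsIIDSeq

variable {X : ℕ → I → ℝ} (hX : IsIIDSeq X)
include hX

lemma comp {g : ℝ → ℝ} (hg : Measurable g) : IsIIDSeq fun i ω => g (X i ω) where
  indep := hX.indep.comp (fun _ => g) fun _ => hg
  measurable i := hg.comp (hX.measurable i)
  ident i := (hX.ident i).comp hg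

lemma precomp {n : ℕ → ℕ} (hn : StrictMono n) : IsIIDSeq fun i => X (n i) where
  indep := hX.indep.precomp hn.injective
  measurable i := hX.measurable (n i)
  ident i := (hX.ident (n i)).trans (hX.ident (n 0)).symm

lemma integral_eq (i : ℕ) : ∫ ω, X i ω = ∫ ω, X 0 ω := (hX.ident i).integral_eq

lemma lorentzENorm_eq_zero_index (ψ : LorentzWeight) (i : ℕ) :
    lorentzENorm ψ (X i) = lorentzENorm ψ (X 0) :=
  lorentzENorm_eq_of_identDistrib ψ (hX.ident i)

lemma isBernoulliSeq (hpos : ∀ i ω, 0 ≤ X i ω) {c : ℝ} :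
    IsBernoulliSeq (fun i ω => if c < X i ω then 1 else 0) (distr (X 0) c) := by
  have hg : Measurable fun z : ℝ => if c < z then (1 : ℝ) else 0 :=
    Measurable.ite (measurableSet_lt measurable_const measurable_id) measurable_const
      measurable_const
  have hY := hX.comp hg
  refine ⟨hY.indep, hY.measurable, fun i ω => ?_, fun i => ?_⟩
  · by_cases h : c < X i ω <;> simp [h]
  · refine (hY.integral_eq i).trans ?_
    have hm : MeasurableSet {ω : I | c < X 0 ω} := measurableSet_lt measurable_const (hX.measurable 0)
    have h1 : (fun ω => if c < X 0 ω then (1 : ℝ) else 0) = {ω : I | c < X 0 ω}.indicator 1 := by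
      funext ω
      simp [indicator_apply]
    rw [h1, integral_indicator_one hm, distr]
    congr 1
    ext ω
    simp [abs_of_nonneg (hpos 0 ω)]

end IsIIDSeq

/-- The staircase `z ↦ ∑_{j ≤ J} h 𝟙(jh < z)`. -/
noncomputable def staircase (h : ℝ) (J : ℕ) (z : ℝ) : ℝ :=
  ∑ j ∈ Finset.range J, h * if (j + 1) * h < z then 1 else 0

lemma measurable_staircase (h : ℝ) (J : ℕ) : Measurable (staircase h J) :=
  Finset.measurable_sum _ fun _ _ => measurable_const.mul
    (Measurable.ite (measurableSet_lt measurable_const measurable_id) measurable_const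
      measurable_const)

/-- The caps `J h` and `(J + 1) h` carry the induction: a new step is added only when `z` exceeds
`(J + 1) h`, so the upper bound has room for it. -/
lemma staircase_bounds {h : ℝ} (hh : 0 < h) (J : ℕ) {z : ℝ} (hz : 0 ≤ z) :
    staircase h J z ≤ min z (J * h) ∧ min z ((J + 1) * h) - h ≤ staircase h J z := by
  induction J with
  | zero => simp [staircase, hz]
  | succ J ih =>
    have hstep : staircase h (J + 1) z = staircase h J z + h * if (J + 1) * h < z then 1 else 0 := by
      rw [staircase, Finset.sum_range_succ, staircase]
    obtain ⟨h1, h2⟩ := ih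
    rw [hstep]
    push_cast
    have h3 := h1.trans (min_le_left _ _)
    have h4 := h1.trans (min_le_right _ _)
    split_ifs with hc
    · rw [min_eq_right hc.le] at h2
      refine ⟨le_min ?_ ?_, ?_⟩
      · linarith
      · linarith
      · have := min_le_right z ((J + 1 + 1) * h)
        linarith
    · rw [not_lt] at hc
      rw [min_eq_left hc] at h2
      refine ⟨le_min ?_ ?_, ?_⟩
      · linarith
      · linarith
      · have := min_le_left z ((J + 1 + 1) * h)
        linarith

lemma abs_sub_staircase_le {h : ℝ} (hh : 0 < h) (J : ℕ) {z : ℝ} (hz : 0 ≤ z) :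
    |z - staircase h J z| ≤ h + max (z - (J + 1) * h) 0 := by
  obtain ⟨h1, h2⟩ := staircase_bounds hh J hz
  have h3 := h1.trans (min_le_left _ _)
  rw [abs_of_nonneg (by linarith)]
  rcases le_total z ((J + 1) * h) with hc | hc
  · rw [min_eq_left hc] at h2
    have := le_max_right (z - (J + 1) * h) 0
    linarith
  · rw [min_eq_right hc] at h2
    have := le_max_left (z - (J + 1) * h) 0
    linarith

/-! ### From indicators to independent copies of an arbitrary function. -/

section Sums

variable (ψ : LorentzWeight)

lemma lorentzENorm_sum_sub_integral_le {R : ℕ → I → ℝ} (hR : IsIIDSeq R) (N : ℕ) :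
    lorentzENorm ψ (∑ i ∈ Finset.range N, fun ω => R i ω - ∫ v, R i v) ≤
      N * (2 * lorentzENorm ψ (R 0)) := by
  refine (lorentzENorm_sum_le ψ _ _ fun i _ =>
    ((hR.measurable i).sub_const _).aemeasurable).trans ?_
  refine (Finset.sum_le_sum fun i _ =>
    lorentzENorm_sub_integral_le ψ (hR.measurable i).aemeasurable).trans_eq ?_
  simp [hR.lorentzENorm_eq_zero_index ψ]

/-- With mesh `1/N` the approximation error of one term is `O(1/N)`, so `N` of them add up to a
constant even by the triangle inequality. The height `J` depends on `Z`, but the bound does not. -/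
lemma lorentzENorm_sub_staircase_le {Z : I → ℝ} (hZ : Measurable Z) (hpos : ∀ ω, 0 ≤ Z ω)
    (hfin : lorentzENorm ψ Z < ∞) {N : ℕ} (hN : 1 ≤ N) :
    ∃ J : ℕ, lorentzENorm ψ (fun ω => Z ω - staircase (1 / N) J (Z ω)) ≤
      (ENNReal.ofReal (ψ 1) + 1) * (N : ℝ≥0∞)⁻¹ := by
  have hN0 : (0 : ℝ) < N := by exact_mod_cast hN
  have hh : (0 : ℝ) < 1 / N := by positivity
  obtain ⟨M₀, _, hM⟩ := exists_tail_small ψ hZ.aemeasurable hfin (ε := (N : ℝ≥0∞)⁻¹) (by simp)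
  obtain ⟨J, hJ⟩ := exists_nat_ge (M₀ / (1 / N))
  rw [div_le_iff₀ hh] at hJ
  refine ⟨J, ?_⟩
  set M := ((J : ℝ) + 1) * (1 / N) with hMdef
  have hMM : M₀ ≤ M := by rw [hMdef]; linarith
  have hm : Measurable fun ω => max (Z ω - M) 0 := (hZ.sub_const M).max measurable_const
  have h1 := hM M hMM (fun ω => max (Z ω - M) 0) hm.aemeasurable fun ω => by
    rw [abs_of_nonneg (le_max_right _ _), abs_of_nonneg (hpos ω)]
  have hc := lorentzENorm_le_of_abs_le ψ (x := fun _ => (1 / N : ℝ)) aemeasurable_const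
    (M := 1 / N) fun _ => (abs_of_pos hh).le
  refine (lorentzENorm_mono ψ (y := (fun _ => (1 / N : ℝ)) + fun ω => max (Z ω - M) 0)
    (hZ.sub ((measurable_staircase _ _).comp hZ)).aemeasurable
    (aemeasurable_const.add hm.aemeasurable) fun ω => ?_).trans
    ((lorentzENorm_add_le ψ aemeasurable_const hm.aemeasurable).trans ((add_le_add hc h1).trans ?_))
  · refine (abs_sub_staircase_le hh J (hpos ω)).trans (le_abs_self _)
  · rw [add_mul, one_mul, mul_comm (1 / (N : ℝ)), ENNReal.ofReal_mul ψ.one_pos.le, one_div,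
      ENNReal.ofReal_inv_of_pos hN0, ENNReal.ofReal_natCast]

variable {r C : ℝ}

/-- Norm bound for centred sums of independent identically distributed nonnegative functions. -/
lemma lorentzENorm_sum_centered_le (hB : HasBernoulliBound ψ r C) (hC : 0 ≤ C)
    {Z : ℕ → I → ℝ} (hZ : IsIIDSeq Z) (hpos : ∀ i ω, 0 ≤ Z i ω)
    (hfin : lorentzENorm ψ (Z 0) < ∞) {N : ℕ} (hN : 1 ≤ N) :
    lorentzENorm ψ (∑ i ∈ Finset.range N, fun ω => Z i ω - ∫ v, Z 0 v) ≤
      ENNReal.ofReal (C * (N : ℝ) ^ r) * lorentzENorm ψ (Z 0) +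
        2 * (ENNReal.ofReal (ψ 1) + 1) := by
  have hN0 : (0 : ℝ) < N := by exact_mod_cast hN
  set h : ℝ := 1 / N with hh
  have hh0 : 0 < h := by positivity
  obtain ⟨J, hJ⟩ := lorentzENorm_sub_staircase_le ψ (hZ.measurable 0) (hpos 0) hfin hN
  set R : ℕ → I → ℝ := fun i ω => Z i ω - staircase h J (Z i ω) with hRdef
  have hR : IsIIDSeq R := hZ.comp (measurable_id.sub (measurable_staircase h J))
  set b : ℕ → ℕ → I → ℝ := fun j i ω => if ((j : ℝ) + 1) * h < Z i ω then 1 else 0 with hbdef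
  have hb : ∀ j, IsBernoulliSeq (b j) (distr (Z 0) ((j + 1) * h)) :=
    fun j => hZ.isBernoulliSeq hpos
  have hZR : ∀ i ω, Z i ω = R i ω + ∑ j ∈ Finset.range J, h * b j i ω := by
    intro i ω
    simp only [hRdef, staircase, hbdef]
    ring
  have hRint : ∀ i, Integrable (R i) volume := by
    intro i
    refine integrable_of_lorentzENorm_lt_top ψ (hR.measurable i).aemeasurable ?_
    rw [hR.lorentzENorm_eq_zero_index ψ]
    refine hJ.trans_lt (ENNReal.mul_lt_top (by simp) ?_)
    rw [ENNReal.inv_lt_top]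
    exact_mod_cast hN
  have hEZ : ∀ i, ∫ v, Z 0 v = (∫ v, R i v) +
      ∑ j ∈ Finset.range J, h * distr (Z 0) ((j + 1) * h) := by
    intro i
    rw [← hZ.integral_eq i]
    simp_rw [hZR i]
    rw [integral_add (hRint i) (integrable_finsetSum _ fun j _ => ((hb j).integrable i).const_mul h),
      integral_finsetSum _ fun j _ => ((hb j).integrable i).const_mul h]
    simp_rw [integral_const_mul, (hb _).mean i]
  -- Exchanging the sums puts the `j`-th layers of all terms together, and each such layer is a
  -- centred sum of independent indicators.
  have hdecomp : (∑ i ∈ Finset.range N, fun ω => Z i ω - ∫ v, Z 0 v) =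
      (∑ i ∈ Finset.range N, fun ω => R i ω - ∫ v, R i v) +
      ∑ j ∈ Finset.range J, h • fun ω =>
        ∑ i ∈ Finset.range N, (b j i ω - distr (Z 0) ((j + 1) * h)) := by
    funext ω
    simp only [Finset.sum_apply, Pi.add_apply, Pi.smul_apply, smul_eq_mul]
    simp_rw [Finset.mul_sum]
    rw [Finset.sum_comm, ← Finset.sum_add_distrib]
    refine Finset.sum_congr rfl fun i _ => ?_
    rw [hEZ i, hZR i ω]
    simp_rw [mul_sub]
    rw [Finset.sum_sub_distrib]
    ring
  have hDm : ∀ j, Measurable fun ω =>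
      ∑ i ∈ Finset.range N, (b j i ω - distr (Z 0) ((j + 1) * h)) := fun j =>
    Finset.measurable_sum _ fun i _ => (hb j).measurable_sub i
  have hRm : AEMeasurable (∑ i ∈ Finset.range N, fun ω => R i ω - ∫ v, R i v) volume :=
    Finset.aemeasurable_sum _ fun i _ => ((hR.measurable i).sub_const _).aemeasurable
  rw [hdecomp]
  refine (lorentzENorm_add_le ψ hRm (Finset.aemeasurable_sum _ fun j _ =>
    ((hDm j).const_smul h).aemeasurable)).trans ?_
  rw [add_comm]
  refine add_le_add ?_ ?_
  · refine (lorentzENorm_sum_le ψ _ _ fun j _ => ((hDm j).const_smul h).aemeasurable).trans ?_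
    -- The constant does not depend on the layer, so the layer bounds add up to a multiple of a
    -- lower Riemann sum of the layer cake integral of `Z 0`.
    have h1 : ∀ j ∈ Finset.range J, lorentzENorm ψ (h • fun ω =>
        ∑ i ∈ Finset.range N, (b j i ω - distr (Z 0) ((j + 1) * h))) ≤
        ENNReal.ofReal (C * (N : ℝ) ^ r) *
          ENNReal.ofReal (h * ψ (distr (Z 0) ((j + 1) * h))) := by
      intro j _
      rw [lorentzENorm_smul, abs_of_pos hh0, ← ENNReal.ofReal_mul (by positivity)]
      refine (mul_le_mul_right (hB _ _ (hb j) N hN) _).trans_eq ?_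
      rw [← ENNReal.ofReal_mul hh0.le]
      ring_nf
    refine (Finset.sum_le_sum h1).trans ?_
    rw [← Finset.mul_sum]
    gcongr
    exact sum_le_lorentzENorm ψ (hZ.measurable 0).aemeasurable hh0 J
  · refine (lorentzENorm_sum_sub_integral_le ψ hR N).trans ?_
    calc (N : ℝ≥0∞) * (2 * lorentzENorm ψ (R 0))
        ≤ N * (2 * ((ENNReal.ofReal (ψ 1) + 1) * (N : ℝ≥0∞)⁻¹)) := by gcongr
      _ = 2 * (ENNReal.ofReal (ψ 1) + 1) * ((N : ℝ≥0∞) * (N : ℝ≥0∞)⁻¹) := by ring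
      _ = _ := by
        rw [ENNReal.mul_inv_cancel (by simpa using by omega) (ENNReal.natCast_ne_top N), mul_one]

/-- Norm bound for sums of independent identically distributed functions with mean zero. -/
lemma lorentzENorm_sum_iid_le (hB : HasBernoulliBound ψ r C) (hC : 0 ≤ C)
    {X : ℕ → I → ℝ} (hX : IsIIDSeq X) (hfin : lorentzENorm ψ (X 0) < ∞) (h0 : ∫ ω, X 0 ω = 0)
    {N : ℕ} (hN : 1 ≤ N) :
    lorentzENorm ψ (∑ i ∈ Finset.range N, X i) ≤
      2 * (ENNReal.ofReal (C * (N : ℝ) ^ r) * lorentzENorm ψ (X 0) +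
        2 * (ENNReal.ofReal (ψ 1) + 1)) := by
  have hP : IsIIDSeq fun i ω => max (X i ω) 0 := hX.comp (g := fun z => max z 0) (by fun_prop)
  have hM : IsIIDSeq fun i ω => max (-X i ω) 0 := hX.comp (g := fun z => max (-z) 0) (by fun_prop)
  have hPle : lorentzENorm ψ (fun ω => max (X 0 ω) 0) ≤ lorentzENorm ψ (X 0) :=
    lorentzENorm_mono ψ (hP.measurable 0).aemeasurable (hX.measurable 0).aemeasurable fun ω => by
      rw [abs_of_nonneg (le_max_right _ _)]
      exact max_le (le_abs_self _) (abs_nonneg _)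
  have hMle : lorentzENorm ψ (fun ω => max (-X 0 ω) 0) ≤ lorentzENorm ψ (X 0) :=
    lorentzENorm_mono ψ (hM.measurable 0).aemeasurable (hX.measurable 0).aemeasurable fun ω => by
      rw [abs_of_nonneg (le_max_right _ _)]
      exact max_le (neg_le_abs _) (abs_nonneg _)
  have hPi := integrable_of_lorentzENorm_lt_top ψ (hP.measurable 0).aemeasurable (hPle.trans_lt hfin)
  have hMi := integrable_of_lorentzENorm_lt_top ψ (hM.measurable 0).aemeasurable (hMle.trans_lt hfin)
  have hsplit : ∀ i ω, X i ω = max (X i ω) 0 - max (-X i ω) 0 := fun i ω => by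
    rcases le_total (X i ω) 0 with h | h
    · rw [max_eq_right h, max_eq_left (by linarith)]
      ring
    · rw [max_eq_left h, max_eq_right (by linarith)]
      ring
  -- Mean zero makes the two centring constants equal, so they cancel in the difference.
  have hE : ∫ ω, max (X 0 ω) 0 = ∫ ω, max (-X 0 ω) 0 := by
    rw [← sub_eq_zero, ← integral_sub hPi hMi]
    exact (integral_congr_ae (Eventually.of_forall fun ω => (hsplit 0 ω).symm)).trans h0
  have hdecomp : ∑ i ∈ Finset.range N, X i =
      (∑ i ∈ Finset.range N, fun ω => max (X i ω) 0 - ∫ v, max (X 0 v) 0) -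
      ∑ i ∈ Finset.range N, fun ω => max (-X i ω) 0 - ∫ v, max (-X 0 v) 0 := by
    rw [← Finset.sum_sub_distrib]
    refine Finset.sum_congr rfl fun i _ => ?_
    funext ω
    rw [Pi.sub_apply, hE, sub_sub_sub_cancel_right]
    exact hsplit i ω
  rw [hdecomp, two_mul (_ + _)]
  refine (lorentzENorm_sub_le ψ
    (Finset.aemeasurable_sum _ fun i _ => ((hP.measurable i).sub_const _).aemeasurable)
    (Finset.aemeasurable_sum _ fun i _ => ((hM.measurable i).sub_const _).aemeasurable)).trans ?_
  refine add_le_add ?_ ?_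
  · refine (lorentzENorm_sum_centered_le ψ hB hC hP (fun _ _ => le_max_right _ _)
      (hPle.trans_lt hfin) hN).trans ?_
    gcongr
  · refine (lorentzENorm_sum_centered_le ψ hB hC hM (fun _ _ => le_max_right _ _)
      (hMle.trans_lt hfin) hN).trans ?_
    gcongr

end Sums

/-! ### Sufficiency -/

section Sufficiency

variable {ψ : LorentzWeight}

lemma Lorentz.integrable (x : Lorentz ψ) : Integrable (x : I →ₘ[volume] ℝ) volume :=
  integrable_of_lorentzENorm_lt_top ψ (x : I →ₘ[volume] ℝ).aemeasurable x.2

lemma Lorentz.abs_integral_le (x : Lorentz ψ) :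
    |∫ ω, (x : I →ₘ[volume] ℝ) ω| ≤ (ψ 1)⁻¹ * ‖x‖ := by
  have h1 := le_lorentzENorm ψ (x := fun _ => ∫ ω, (x : I →ₘ[volume] ℝ) ω) aemeasurable_const
    (abs_nonneg (∫ ω, (x : I →ₘ[volume] ℝ) ω)) zero_le_one (by simp)
  have h2 := h1.trans (lorentzENorm_const_integral_le ψ (x : I →ₘ[volume] ℝ).aemeasurable)
  rw [inv_mul_eq_div, le_div_iff₀ ψ.one_pos]
  exact (ENNReal.ofReal_le_iff_le_toReal x.2.ne).1 h2

/-- Integration as a continuous functional on the Lorentz space. -/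
noncomputable def Lorentz.integralL (ψ : LorentzWeight) : StrongDual ℝ (Lorentz ψ) :=
  LinearMap.mkContinuous
    { toFun := fun x => ∫ ω, (x : I →ₘ[volume] ℝ) ω
      map_add' := fun x y => by
        rw [← integral_add (Lorentz.integrable x) (Lorentz.integrable y)]
        exact integral_congr_ae (AEEqFun.coeFn_add _ _)
      map_smul' := fun c x => by
        rw [RingHom.id_apply, ← integral_smul]
        exact integral_congr_ae (AEEqFun.coeFn_smul _ _) } (ψ 1)⁻¹ Lorentz.abs_integral_le

lemma isIIDSeq_of_isIID {x : ℕ → Lorentz ψ} (hx : IsIID fun n => (x n : I →ₘ[volume] ℝ)) :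
    IsIIDSeq fun n => ((x n : I →ₘ[volume] ℝ) : I → ℝ) :=
  ⟨hx.1, fun n => (x n : I →ₘ[volume] ℝ).measurable, hx.2⟩

lemma norm_eq_of_isIID {x : ℕ → Lorentz ψ} (hx : IsIID fun n => (x n : I →ₘ[volume] ℝ)) (n : ℕ) :
    ‖x n‖ = ‖x 0‖ := by
  rw [norm_def, norm_def, lorentzENorm_eq_of_identDistrib ψ (hx.2 n)]

lemma isBounded_range_of_isIID {x : ℕ → Lorentz ψ} (hx : IsIID fun n => (x n : I →ₘ[volume] ℝ)) :
    Bornology.IsBounded (range x) := by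
  refine isBounded_iff_forall_norm_le.2 ⟨‖x 0‖, ?_⟩
  rintro _ ⟨n, rfl⟩
  exact (norm_eq_of_isIID hx n).le

/-- The integral is a continuous functional, and it is constant along identically distributed
functions. -/
lemma integral_eq_zero_of_isWeaklyNull {x : ℕ → Lorentz ψ} (hw : IsWeaklyNull x)
    (hx : IsIID fun n => (x n : I →ₘ[volume] ℝ)) : ∫ ω, (x 0 : I →ₘ[volume] ℝ) ω = 0 := by
  have h1 := hw (Lorentz.integralL ψ)
  have h2 : (fun n => Lorentz.integralL ψ (x n)) = fun _ => ∫ ω, (x 0 : I →ₘ[volume] ℝ) ω :=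
    funext fun n => (isIIDSeq_of_isIID hx).integral_eq n
  rw [h2] at h1
  exact tendsto_nhds_unique tendsto_const_nhds h1

lemma norm_sum_eq {ι : Type*} (s : Finset ι) (y : ι → Lorentz ψ) :
    ‖∑ k ∈ s, y k‖ =
      (lorentzENorm ψ (∑ k ∈ s, ((y k : I →ₘ[volume] ℝ) : I → ℝ))).toReal := by
  rw [norm_def, AddSubmonoidClass.coe_finsetSum, lorentzENorm_congr ψ (AEEqFun.coeFn_finsetSum _ _)]

/-- Take `p = 1 / r` with `r` the exponent of the indicator bound. No extraction is needed: every
subsequence is again i.i.d. with the same law, so the same bound applies. -/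
lemma exists_one_lt_mem_gammaIid
    (hk : ∃ k : ℕ, 2 ≤ k ∧ limsup (fun u : ℝ => ψ (k * u) / ψ u) (𝓝[>] 0) < k)
    (hl : ∃ l : ℕ, 2 ≤ l ∧ limsup (fun u : ℝ => ψ (u ^ l) / ψ u) (𝓝[>] 0) < 1) :
    ∃ p ∈ gammaIid ψ, 1 < p := by
  obtain ⟨r, C, hr0, hr1, hC, hB⟩ := exists_bernoulli_bound ψ hk hl
  have hp : 1 < 1 / r := (one_lt_div hr0).2 hr1
  refine ⟨1 / r, ⟨hp.le, fun x hw hx => ⟨id, strictMono_id, isBounded_range_of_isIID hx,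
    fun n hn => ?_⟩⟩, hp⟩
  have hY := (isIIDSeq_of_isIID hx).precomp hn
  have hmean : ∫ ω, (x (n 0) : I →ₘ[volume] ℝ) ω = 0 :=
    ((isIIDSeq_of_isIID hx).integral_eq (n 0)).trans (integral_eq_zero_of_isWeaklyNull hw hx)
  set a := ‖x (n 0)‖ with ha
  have ha0 : 0 ≤ a := norm_nonneg _
  have hψ1 := ψ.one_pos
  refine ⟨2 * (C * a + 2 * (ψ 1 + 1)), fun m hm => ?_⟩
  have hm1 : (1 : ℝ) ≤ m := by exact_mod_cast hm
  have hm0 : (0 : ℝ) < m := by linarith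
  have h1 := lorentzENorm_sum_iid_le ψ hB hC hY (x (n 0)).2 hmean hm
  have h2 : ‖∑ k ∈ Finset.range m, x (n k)‖ ≤ 2 * (C * (m : ℝ) ^ r * a + 2 * (ψ 1 + 1)) := by
    rw [norm_sum_eq]
    refine ENNReal.toReal_le_of_le_ofReal (by positivity) (h1.trans_eq ?_)
    rw [← ENNReal.ofReal_toReal (x (n 0)).2.ne, ← norm_def, ← ha,
      ← ENNReal.ofReal_mul (p := C * (m : ℝ) ^ r) (by positivity),
      ENNReal.ofReal_mul (p := 2) (by norm_num), ENNReal.ofReal_add (by positivity) (by positivity),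
      ENNReal.ofReal_mul (p := 2) (q := ψ 1 + 1) (by norm_num), ENNReal.ofReal_add hψ1.le zero_le_one]
    simp
  have h3 : (m : ℝ) ^ (-r) ≤ 1 := Real.rpow_le_one_of_one_le_of_nonpos hm1 (by linarith)
  have h4 : (m : ℝ) ^ (-r) * (m : ℝ) ^ r = 1 := by
    rw [← Real.rpow_add hm0, neg_add_cancel, Real.rpow_zero]
  simp only [id, Function.comp, one_div_one_div]
  calc (m : ℝ) ^ (-r) * ‖∑ k ∈ Finset.range m, x (n k)‖
      ≤ (m : ℝ) ^ (-r) * (2 * (C * (m : ℝ) ^ r * a + 2 * (ψ 1 + 1))) := by gcongr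
    _ = 2 * (C * a * ((m : ℝ) ^ (-r) * (m : ℝ) ^ r) + (m : ℝ) ^ (-r) * (2 * (ψ 1 + 1))) := by ring
    _ ≤ 2 * (C * a * 1 + 1 * (2 * (ψ 1 + 1))) := by rw [h4]; gcongr
    _ = _ := by ring

lemma one_mem_gammaIid : (1 : ℝ) ∈ gammaIid ψ := by
  refine ⟨le_rfl, fun x _ hx => ⟨id, strictMono_id, isBounded_range_of_isIID hx,
    fun n _ => ⟨‖x 0‖, fun m hm => ?_⟩⟩⟩
  have hm0 : (0 : ℝ) < m := by exact_mod_cast hm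
  rw [div_one, Real.rpow_neg_one, inv_mul_le_iff₀ hm0]
  refine (norm_sum_le _ _).trans_eq ?_
  simp [norm_eq_of_isIID hx]

end Sufficiency

/-! ### Independent uniform variables -/

/-- A sequence of independent uniformly distributed maps of `[0,1]` to itself. -/
structure IsUniformSeq (ξ : ℕ → I → I) : Prop where
  indep : iIndepFun ξ volume
  measurePreserving : ∀ i, MeasurePreserving (ξ i) volume volume

/-- `[0,1]` with Lebesgue measure maps measurably onto the law of the infinite product of copies of
itself; the coordinates of such a map are independent and uniform. -/
lemma exists_isUniformSeq : ∃ ξ : ℕ → I → I, IsUniformSeq ξ := by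
  obtain ⟨f, hf, hmap⟩ := Measure.exists_measurable_map_eq
    (Measure.infinitePi fun _ : ℕ => (volume : Measure I))
  have hm : ∀ i, Measurable fun ω => f ω i := fun i => (measurable_pi_apply i).comp hf
  have hl : ∀ i, volume.map (fun ω => f ω i) = volume := by
    intro i
    have h := Measure.infinitePi_map_eval (fun _ : ℕ => (volume : Measure I)) i
    rwa [← hmap, Measure.map_map (measurable_pi_apply i) hf] at h
  refine ⟨fun i ω => f ω i, ?_, fun i => ⟨hm i, hl i⟩⟩
  rw [iIndepFun_iff_map_fun_eq_infinitePi_map hm]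
  simp_rw [hl]
  exact hmap

namespace IsUniformSeq

variable {ξ : ℕ → I → I} (hξ : IsUniformSeq ξ)
include hξ

lemma measurable (i : ℕ) : Measurable (ξ i) := (hξ.measurePreserving i).measurable

lemma precomp {n : ℕ → ℕ} (hn : StrictMono n) : IsUniformSeq fun i => ξ (n i) :=
  ⟨hξ.indep.precomp hn.injective, fun i => hξ.measurePreserving (n i)⟩

lemma map_eq : volume.map (fun ω i => ξ i ω) = Measure.infinitePi fun _ : ℕ => (volume : Measure I) := by
  rw [(iIndepFun_iff_map_fun_eq_infinitePi_map hξ.measurable).1 hξ.indep]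
  simp_rw [(hξ.measurePreserving _).map_eq]

lemma symm : IsUniformSeq fun i ω => σ (ξ i ω) :=
  ⟨hξ.indep.comp (fun _ => σ) fun _ => unitInterval.measurable_symm,
    fun i => unitInterval.measurePreserving_symm.comp (hξ.measurePreserving i)⟩

lemma identDistrib {F : I → ℝ} (hF : Measurable F) (i : ℕ) :
    IdentDistrib (fun ω => F (ξ i ω)) F volume volume where
  aemeasurable_fst := (hF.comp (hξ.measurable i)).aemeasurable
  aemeasurable_snd := hF.aemeasurable
  map_eq := by
    change volume.map (F ∘ ξ i) = _
    rw [← Measure.map_map hF (hξ.measurable i), (hξ.measurePreserving i).map_eq]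

lemma isIIDSeq {F : I → ℝ} (hF : Measurable F) : IsIIDSeq fun i ω => F (ξ i ω) where
  indep := hξ.indep.comp (fun _ => F) fun _ => hF
  measurable i := hF.comp (hξ.measurable i)
  ident i := (hξ.identDistrib hF i).trans (hξ.identDistrib hF 0).symm

/-- Sums of odd functions of uniform variables are symmetric. -/
lemma half_le_measureReal_sum_nonneg {F : I → ℝ} (hF : Measurable F) (hodd : ∀ t, F (σ t) = -F t)
    (s : Finset ℕ) : 1 / 2 ≤ volume.real {ω : I | 0 ≤ ∑ k ∈ s, F (ξ k ω)} := by
  set A : Set (ℕ → I) := {w | 0 ≤ ∑ k ∈ s, F (w k)} with hA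
  have hAm : MeasurableSet A := measurableSet_le measurable_const
    (Finset.measurable_sum s fun k _ => hF.comp (measurable_pi_apply k))
  -- The reflected sequence is again independent and uniform, so it has the same joint law, and
  -- oddness turns reflection into a change of sign of the sum.
  have h1 : volume ((fun ω i => ξ i ω) ⁻¹' A) = volume ((fun ω i => σ (ξ i ω)) ⁻¹' A) := by
    rw [← Measure.map_apply (measurable_pi_lambda _ hξ.measurable) hAm,
      ← Measure.map_apply (measurable_pi_lambda _ hξ.symm.measurable) hAm, hξ.map_eq,
      hξ.symm.map_eq]
  have h2 : (fun ω i => σ (ξ i ω)) ⁻¹' A = {ω : I | ∑ k ∈ s, F (ξ k ω) ≤ 0} := by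
    ext ω
    simp [hA, hodd]
  rw [h2] at h1
  have h3 : volume.real {ω : I | 0 ≤ ∑ k ∈ s, F (ξ k ω)} =
      volume.real {ω : I | ∑ k ∈ s, F (ξ k ω) ≤ 0} := congrArg ENNReal.toReal h1
  have h4 := measureReal_union_le (μ := volume) {ω : I | 0 ≤ ∑ k ∈ s, F (ξ k ω)}
    {ω : I | ∑ k ∈ s, F (ξ k ω) ≤ 0}
  have h5 : {ω : I | 0 ≤ ∑ k ∈ s, F (ξ k ω)} ∪ {ω : I | ∑ k ∈ s, F (ξ k ω) ≤ 0} = univ :=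
    eq_univ_of_forall fun ω => le_total (0 : ℝ) (∑ k ∈ s, F (ξ k ω))
  rw [h5, ← h3, probReal_univ] at h4
  linarith

lemma measureReal_preimage (i : ℕ) {A : Set I} (hA : MeasurableSet A) :
    volume.real (ξ i ⁻¹' A) = volume.real A :=
  congrArg ENNReal.toReal ((hξ.measurePreserving i).measure_preimage hA.nullMeasurableSet)

lemma measureReal_inter_preimage {i k : ℕ} (hik : i ≠ k) {A : Set I} (hA : MeasurableSet A) :
    volume.real (ξ i ⁻¹' A ∩ ξ k ⁻¹' A) = volume.real A ^ 2 := by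
  rw [measureReal_def, (hξ.indep.indepFun hik).measure_inter_preimage_eq_mul A A hA hA,
    ENNReal.toReal_mul, ← measureReal_def, ← measureReal_def, hξ.measureReal_preimage i hA,
    hξ.measureReal_preimage k hA, sq]

lemma indepFun_sum {F : I → ℝ} (hF : Measurable F) {i : ℕ} {s : Finset ℕ} (hi : i ∉ s) :
    IndepFun (ξ i) (fun ω => ∑ k ∈ s, F (ξ k ω)) volume := by
  have h := hξ.indep.indepFun_finset {i} s (Finset.disjoint_singleton_left.2 hi) hξ.measurable
  have hg : Measurable fun w : s → I => ∑ k : s, F (w k) :=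
    Finset.measurable_sum _ fun k _ => hF.comp (measurable_pi_apply k)
  have h2 := h.comp (measurable_pi_apply (⟨i, Finset.mem_singleton_self i⟩ : ({i} : Finset ℕ))) hg
  refine h2.congr (Eventually.of_forall fun ω => rfl) (Eventually.of_forall fun ω => ?_)
  exact Finset.sum_coe_sort s fun k => F (ξ k ω)

/-- All terms exceed `c` with probability `u ^ N`. -/
lemma pow_le_measureReal_sum {F : I → ℝ} {A : Set I} (hA : MeasurableSet A) {c : ℝ}
    (hFA : ∀ t ∈ A, c ≤ F t) (N : ℕ) :
    volume.real A ^ N ≤ volume.real {ω : I | N * c ≤ |∑ i ∈ Finset.range N, F (ξ i ω)|} := by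
  have h1 := hξ.indep.measure_inter_preimage_eq_mul (Finset.range N) (sets := fun _ => A)
    fun _ _ => hA
  have h2 : volume.real (⋂ i ∈ Finset.range N, ξ i ⁻¹' A) = volume.real A ^ N := by
    rw [measureReal_def, h1, ENNReal.toReal_prod]
    simp_rw [← measureReal_def, hξ.measureReal_preimage _ hA]
    simp
  rw [← h2]
  refine measureReal_mono fun ω hω => ?_
  simp only [mem_iInter, mem_preimage] at hω
  refine le_trans ?_ (le_abs_self (∑ i ∈ Finset.range N, F (ξ i ω)))
  calc (N : ℝ) * c = ∑ i ∈ Finset.range N, c := by simp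
    _ ≤ _ := Finset.sum_le_sum fun i hi => hFA _ (hω i hi)

/-- With probability comparable to `N * u`, a single large term dominates the sum. -/
lemma mul_le_measureReal_sum {F : I → ℝ} (hF : Measurable F) (hodd : ∀ t, F (σ t) = -F t)
    {A : Set I} (hA : MeasurableSet A) {c : ℝ} (hFA : ∀ t ∈ A, c ≤ F t) {N : ℕ}
    (hN : 4 * N * volume.real A ≤ 1) :
    N * volume.real A / 4 ≤ volume.real {ω : I | c ≤ |∑ i ∈ Finset.range N, F (ξ i ω)|} := by
  classical
  set u := volume.real A with hu
  have hu0 : 0 ≤ u := measureReal_nonneg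
  set R := Finset.range N with hR
  set P : ℕ → Set I := fun i => {ω | 0 ≤ ∑ k ∈ R.erase i, F (ξ k ω)} with hP
  have hPm : ∀ i, MeasurableSet (P i) := fun i => measurableSet_le measurable_const
    (Finset.measurable_sum _ fun k _ => hF.comp (hξ.measurable k))
  set B : ℕ → Set I := fun i => ⋃ k ∈ R.erase i, ξ i ⁻¹' A ∩ ξ k ⁻¹' A with hB
  -- On `H i` only the `i`-th variable hits `A` and the other terms have nonnegative sum, so the
  -- total is at least `c`. These events are disjoint, each of measure at least `u/2 - N u² ≥ u/4`.
  set H : ℕ → Set I := fun i => (ξ i ⁻¹' A ∩ P i) \ B i with hH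
  have hpre : ∀ i, MeasurableSet (ξ i ⁻¹' A) := fun i => hξ.measurable i hA
  have hHm : ∀ i, MeasurableSet (H i) := fun i => ((hpre i).inter (hPm i)).diff
    (Finset.measurableSet_biUnion _ fun k _ => (hpre i).inter (hpre k))
  have hG : ∀ i, u / 2 ≤ volume.real (ξ i ⁻¹' A ∩ P i) := by
    intro i
    have h1 : volume (ξ i ⁻¹' A ∩ P i) = volume (ξ i ⁻¹' A) * volume (P i) :=
      (hξ.indepFun_sum hF (Finset.notMem_erase i R)).measure_inter_preimage_eq_mul A (Ici 0) hA
        measurableSet_Ici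
    rw [measureReal_def, h1, ENNReal.toReal_mul, ← measureReal_def, ← measureReal_def,
      hξ.measureReal_preimage i hA]
    have := hξ.half_le_measureReal_sum_nonneg hF hodd (R.erase i)
    calc u / 2 = u * (1 / 2) := by ring
      _ ≤ _ := by gcongr
  have hBle : ∀ i, volume.real (B i) ≤ N * u ^ 2 := by
    intro i
    refine (measureReal_biUnion_finset_le _ _).trans ?_
    calc ∑ k ∈ R.erase i, volume.real (ξ i ⁻¹' A ∩ ξ k ⁻¹' A) = ∑ k ∈ R.erase i, u ^ 2 :=
          Finset.sum_congr rfl fun k hk =>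
            hξ.measureReal_inter_preimage (Finset.ne_of_mem_erase hk).symm hA
      _ = (R.erase i).card * u ^ 2 := by simp
      _ ≤ N * u ^ 2 := by
          gcongr
          exact (Finset.card_erase_le).trans_eq (Finset.card_range N)
  have hHge : ∀ i, u / 4 ≤ volume.real (H i) := by
    intro i
    have h1 : volume.real (ξ i ⁻¹' A ∩ P i) - volume.real (B i) ≤ volume.real (H i) :=
      le_measureReal_sdiff (measure_ne_top _ _)
    have h2 := hG i
    have h3 := hBle i
    nlinarith
  have hdisj : (R : Set ℕ).PairwiseDisjoint H := by
    intro i hi k hk hik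
    refine disjoint_left.2 fun ω hω hω' => hω.2 ?_
    simp only [hB, mem_iUnion]
    exact ⟨k, Finset.mem_erase.2 ⟨hik.symm, hk⟩, hω.1.1, hω'.1.1⟩
  have hsub : ⋃ i ∈ R, H i ⊆ {ω : I | c ≤ |∑ i ∈ R, F (ξ i ω)|} := by
    intro ω hω
    simp only [mem_iUnion] at hω
    obtain ⟨i, hi, hω⟩ := hω
    refine le_trans ?_ (le_abs_self (∑ i ∈ R, F (ξ i ω)))
    rw [← Finset.add_sum_erase R _ hi]
    have h1 := hFA _ hω.1.1
    have h2 : 0 ≤ ∑ k ∈ R.erase i, F (ξ k ω) := hω.1.2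
    linarith
  calc N * u / 4 = ∑ i ∈ R, u / 4 := by
        rw [Finset.sum_const, hR, Finset.card_range, nsmul_eq_mul]
        ring
    _ ≤ ∑ i ∈ R, volume.real (H i) := Finset.sum_le_sum fun i _ => hHge i
    _ = volume.real (⋃ i ∈ R, H i) := (measureReal_biUnion_finset hdisj fun i _ => hHm i).symm
    _ ≤ _ := measureReal_mono hsub

end IsUniformSeq

/-! ### Lower bounds when one of the limit conditions fails -/

section LowerBound

variable (ψ : LorentzWeight)

/-- Independent copies of an indicator of a set of measure `u` add up almost like multiples. -/
def IsExtremal (N : ℕ) (u : ℝ) : Prop :=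
  ψ u / 2 ≤ ψ (u ^ N) ∨ 4 * N * u ≤ 1 ∧ N * ψ u / 2 ≤ ψ (N * u)

lemma exists_isExtremal
    (h : ¬ ((∃ k : ℕ, 2 ≤ k ∧ limsup (fun u : ℝ => ψ (k * u) / ψ u) (𝓝[>] 0) < k) ∧
      (∃ l : ℕ, 2 ≤ l ∧ limsup (fun u : ℝ => ψ (u ^ l) / ψ u) (𝓝[>] 0) < 1)))
    {N : ℕ} (hN : 2 ≤ N) {δ : ℝ} (hδ : 0 < δ) : ∃ u ∈ Ioo 0 δ, IsExtremal ψ N u := by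
  have hN0 : (0 : ℝ) < N := by positivity
  rcases not_and_or.1 h with h | h
  -- Taking `u` below `1 / (4N)` as well secures the side condition `4 N u ≤ 1`.
  · obtain ⟨u, hu, hψ⟩ := exists_half_mul_le ψ h hN
      (lt_min hδ (by positivity : (0 : ℝ) < 1 / (4 * N)))
    have h1 := hu.2.trans_le (min_le_left _ _)
    refine ⟨u, ⟨hu.1, h1.trans_le (min_le_left _ _)⟩, Or.inr ⟨?_, hψ⟩⟩
    have h2 := h1.trans_le (min_le_right _ _)
    rw [lt_div_iff₀ (by positivity)] at h2
    linarith
  · obtain ⟨u, hu, hψ⟩ := exists_half_le_pow ψ h hN hδ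
    exact ⟨u, ⟨hu.1, hu.2.trans_le (min_le_left _ _)⟩, Or.inl hψ⟩

/-- In the first case all terms are large together: size `N c` on measure `u^N`. In the second a
single large term suffices: size `c` on measure `N u / 4`, where the `4` and the `2` of extremality
make the `8`. -/
lemma le_lorentzENorm_sum_of_isExtremal {ξ : ℕ → I → I} (hξ : IsUniformSeq ξ) {F : I → ℝ}
    (hF : Measurable F) (hodd : ∀ t, F (σ t) = -F t) {A : Set I} (hA : MeasurableSet A) {c : ℝ}
    (hc : 0 ≤ c) (hFA : ∀ t ∈ A, c ≤ F t) {N : ℕ} (hext : IsExtremal ψ N (volume.real A)) :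
    ENNReal.ofReal (N * c * ψ (volume.real A) / 8) ≤
      lorentzENorm ψ (∑ i ∈ Finset.range N, fun ω => F (ξ i ω)) := by
  set u := volume.real A with hu
  have hu0 : 0 ≤ u := measureReal_nonneg
  have hu1 : u ≤ 1 := measureReal_le_one
  have hψu := ψ.nonneg hu0 hu1
  have hm : AEMeasurable (∑ i ∈ Finset.range N, fun ω => F (ξ i ω)) volume :=
    Finset.aemeasurable_sum _ fun i _ => (hF.comp (hξ.measurable i)).aemeasurable
  have hNc : 0 ≤ N * c := by positivity
  rcases hext with h | ⟨h4, h⟩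
  · refine le_trans (ENNReal.ofReal_le_ofReal ?_)
      (le_lorentzENorm ψ hm hNc (pow_nonneg hu0 N) ?_)
    · calc N * c * ψ u / 8 ≤ N * c * (ψ u / 2) := by nlinarith [mul_nonneg hNc hψu]
        _ ≤ _ := by gcongr
    · have := hξ.pow_le_measureReal_sum hA hFA N
      simpa only [Finset.sum_apply] using this
  · have hNu : 0 ≤ N * u := by positivity
    refine le_trans (ENNReal.ofReal_le_ofReal ?_)
      (le_lorentzENorm ψ hm hc (t := N * u / 4) (by positivity) ?_)
    · have h1 := ψ.mul_le (c := 1 / 4) (by norm_num) (by norm_num) hNu (by linarith)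
      have h2 : N * ψ u / 8 ≤ ψ (N * u / 4) := by
        rw [show N * u / 4 = 1 / 4 * (N * u) by ring]
        linarith
      calc N * c * ψ u / 8 = c * (N * ψ u / 8) := by ring
        _ ≤ _ := by gcongr
    · have := hξ.mul_le_measureReal_sum hF hodd hA hFA h4
      simpa only [Finset.sum_apply] using this

end LowerBound

/-! ### A law of large numbers in the Lorentz norm -/

section LawOfLargeNumbers

variable (ψ : LorentzWeight)

lemma LorentzWeight.exists_small {η : ℝ} (hη : 0 < η) : ∃ τ ∈ Ioc (0 : ℝ) 1, ψ τ < η := by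
  have h1 := (ψ.continuousOn 0 (left_mem_Icc.2 zero_le_one)).mono Ioc_subset_Icc_self
  have h2 : Tendsto ψ (𝓝[>] 0) (𝓝 0) := by
    have := h1.tendsto
    rwa [ψ.map_zero, nhdsWithin_Ioc_eq_nhdsGT zero_lt_one] at this
  obtain ⟨τ, h3, h4⟩ := ((h2.eventually (gt_mem_nhds hη)).and (Ioc_mem_nhdsGT zero_lt_one)).exists
  exact ⟨τ, h4, h3⟩

/-- Averages of bounded independent centred functions tend to zero in norm. -/
lemma exists_forall_lorentzENorm_sum_le_of_bounded {Y : ℕ → I → ℝ} (hind : iIndepFun Y volume)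
    (hY : ∀ i, Measurable (Y i)) {M : ℝ} (hM0 : 0 < M) (hM : ∀ i ω, |Y i ω| ≤ M)
    (h0 : ∀ i, ∫ ω, Y i ω = 0) {η : ℝ} (hη : 0 < η) :
    ∃ N₀ : ℕ, ∀ N : ℕ, N₀ ≤ N →
      lorentzENorm ψ (∑ i ∈ Finset.range N, Y i) ≤ ENNReal.ofReal (η * N) := by
  have hψ1 := ψ.one_pos
  set δ := η / (2 * ψ 1) with hδ
  have hδ0 : 0 < δ := by positivity
  -- Levels below `δ N` cost at most `δ N ψ(1) = ηN/2`. Above them the tail is at most `τ` by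
  -- Chebyshev, and the bound `N M` on the sum makes the cost at most `N M ψ(τ) ≤ ηN/2`.
  obtain ⟨τ, hτ, hψτ⟩ := ψ.exists_small (by positivity : 0 < η / (2 * M))
  obtain ⟨N₀, hN₀⟩ := exists_nat_ge (M ^ 2 / (δ ^ 2 * τ))
  refine ⟨N₀ + 1, fun N hN => ?_⟩
  have hN0 : (0 : ℝ) < N := by exact_mod_cast (by omega : 0 < N)
  have hNN : (N₀ : ℝ) ≤ N := by exact_mod_cast (by omega : N₀ ≤ N)
  have hSm : AEMeasurable (∑ i ∈ Finset.range N, Y i) volume :=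
    Finset.aemeasurable_sum _ fun i _ => (hY i).aemeasurable
  have hbd : ∀ ω, |(∑ i ∈ Finset.range N, Y i) ω| ≤ N * M := fun ω => by
    rw [Finset.sum_apply]
    exact (Finset.abs_sum_le_sum_abs _ _).trans
      ((Finset.sum_le_sum fun i _ => hM i ω).trans_eq (by simp))
  have hsq : ∀ i, ∫ ω, Y i ω ^ 2 ≤ M ^ 2 := fun i => by
    have h1 : ∀ ω, Y i ω ^ 2 ≤ M ^ 2 := fun ω => sq_le_sq.2 ((hM i ω).trans (le_abs_self M))
    refine (integral_mono_of_nonneg (Eventually.of_forall fun ω => sq_nonneg _)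
      (integrable_const (M ^ 2)) (Eventually.of_forall h1)).trans_eq (by simp)
  have hdistr : distr (∑ i ∈ Finset.range N, Y i) (δ * N) ≤ τ := by
    have h1 := measureReal_abs_sum_ge_le_sq hind hY hM h0 hsq N (s := δ * N) (by positivity)
    refine (measureReal_mono fun ω (hω : δ * N < _) => ?_).trans (h1.trans ?_)
    · rw [Finset.sum_apply] at hω
      exact hω.le
    · have hτ0 := hτ.1
      rw [div_le_iff₀ (by positivity)] at hN₀ ⊢
      have h2 : M ^ 2 ≤ N * (δ ^ 2 * τ) := hN₀.trans (by gcongr)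
      calc N * M ^ 2 ≤ N * (N * (δ ^ 2 * τ)) := by gcongr
        _ = τ * (δ * N) ^ 2 := by ring
  refine (lorentzENorm_le_of_bounded ψ hSm hbd (by positivity : 0 ≤ δ * N)).trans ?_
  have h1 : ∫⁻ s in Ioc 0 (δ * N), ENNReal.ofReal (ψ (distr (∑ i ∈ Finset.range N, Y i) s)) ≤
      ENNReal.ofReal (η / 2 * N) := by
    calc _ ≤ ∫⁻ _ in Ioc 0 (δ * N), ENNReal.ofReal (ψ 1) :=
          lintegral_mono fun s => ψ.mono_distr (distr_nonneg _) (distr_le_one _) le_rfl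
      _ = ENNReal.ofReal (η / 2 * N) := by
          rw [lintegral_const, Measure.restrict_apply_univ, Real.volume_Ioc, sub_zero,
            ← ENNReal.ofReal_mul hψ1.le, hδ]
          congr 1
          field_simp
  have h2 : N * M * ψ (distr (∑ i ∈ Finset.range N, Y i) (δ * N)) ≤ η / 2 * N := by
    calc _ ≤ N * M * (η / (2 * M)) := by
          gcongr
          exact (ψ.mono (distr_nonneg _) hdistr hτ.2).trans hψτ.le
      _ = η / 2 * N := by field_simp
  refine (add_le_add h1 (ENNReal.ofReal_le_ofReal h2)).trans_eq ?_
  rw [← ENNReal.ofReal_add (by positivity) (by positivity)]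
  congr 1
  ring

/-- Averages of odd functions of independent uniform variables tend to zero in norm. -/
lemma exists_lorentzENorm_sum_le {ξ : ℕ → I → I} (hξ : IsUniformSeq ξ) {F : I → ℝ}
    (hF : Measurable F) (hodd : ∀ t, F (σ t) = -F t) (hfin : lorentzENorm ψ F < ∞) {η : ℝ}
    (hη : 0 < η) :
    ∃ N : ℕ, 1 ≤ N ∧
      lorentzENorm ψ (∑ i ∈ Finset.range N, fun ω => F (ξ i ω)) ≤ ENNReal.ofReal (η * N) := by
  obtain ⟨M₀, hM₀, hM⟩ := exists_tail_small ψ hF.aemeasurable hfin (ε := ENNReal.ofReal (η / 2))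
    (by simpa using hη)
  set M := M₀ + 1 with hMdef
  have hM0 : 0 < M := by linarith
  -- Symmetric truncation preserves oddness, hence mean zero, and leaves a remainder of small norm.
  set G : I → ℝ := fun t => max (-M) (min (F t) M) with hG
  have hGm : Measurable G := measurable_const.max (hF.min measurable_const)
  have hGM : ∀ t, |G t| ≤ M := fun t =>
    abs_le.2 ⟨le_max_left _ _, max_le (by linarith) (min_le_right _ _)⟩
  have hGodd : ∀ t, G (σ t) = -G t := by
    intro t
    simp only [hG, hodd]
    simp only [max_def, min_def]
    split_ifs <;> linarith
  have hG0 : ∫ t, G t = 0 := by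
    have h1 := unitInterval.measurePreserving_symm.integral_comp
      unitInterval.symmMeasurableEquiv.measurableEmbedding G
    simp_rw [hGodd] at h1
    rw [integral_neg] at h1
    linarith
  have hFG : ∀ t, |F t - G t| ≤ max (|F t| - M) 0 := by
    intro t
    have h3 := le_max_left (|F t| - M) 0
    have h4 := le_max_right (|F t| - M) 0
    have h5 := le_abs_self (F t)
    have h6 := neg_abs_le (F t)
    refine abs_le.2 ?_
    simp only [hG]
    rcases le_total (F t) M with h1 | h1
    · rw [min_eq_left h1]
      rcases le_total (-M) (F t) with h2 | h2
      · rw [max_eq_right h2]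
        constructor <;> linarith
      · rw [max_eq_left h2]
        constructor <;> linarith
    · rw [min_eq_right h1, max_eq_right (a := -M) (b := M) (by linarith)]
      constructor <;> linarith
  have hR : lorentzENorm ψ (fun t => F t - G t) ≤ ENNReal.ofReal (η / 2) :=
    hM M (by linarith) _ (hF.sub hGm).aemeasurable hFG
  have hGi := hξ.isIIDSeq hGm
  obtain ⟨N₀, hN₀⟩ := exists_forall_lorentzENorm_sum_le_of_bounded ψ hGi.indep hGi.measurable hM0
    (fun i ω => hGM _) (fun i => ((hξ.identDistrib hGm i).integral_eq).trans hG0) (half_pos hη)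
  refine ⟨N₀ + 1, by omega, ?_⟩
  set N := N₀ + 1
  have hdecomp : (∑ i ∈ Finset.range N, fun ω => F (ξ i ω)) =
      (∑ i ∈ Finset.range N, fun ω => F (ξ i ω) - G (ξ i ω)) +
      ∑ i ∈ Finset.range N, fun ω => G (ξ i ω) := by
    rw [← Finset.sum_add_distrib]
    refine Finset.sum_congr rfl fun i _ => ?_
    funext ω
    simp
  have hRm : ∀ i, AEMeasurable (fun ω => F (ξ i ω) - G (ξ i ω)) volume := fun i =>
    ((hF.sub hGm).comp (hξ.measurable i)).aemeasurable
  rw [hdecomp]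
  refine (lorentzENorm_add_le ψ (Finset.aemeasurable_sum _ fun i _ => hRm i)
    (Finset.aemeasurable_sum _ fun i _ => (hGi.measurable i).aemeasurable)).trans ?_
  have h1 : lorentzENorm ψ (∑ i ∈ Finset.range N, fun ω => F (ξ i ω) - G (ξ i ω)) ≤
      ENNReal.ofReal (η / 2 * N) := by
    refine (lorentzENorm_sum_le ψ _ _ fun i _ => hRm i).trans ?_
    calc ∑ i ∈ Finset.range N, lorentzENorm ψ (fun ω => F (ξ i ω) - G (ξ i ω))
        ≤ ∑ _i ∈ Finset.range N, ENNReal.ofReal (η / 2) := Finset.sum_le_sum fun i _ =>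
          (lorentzENorm_eq_of_identDistrib ψ (hξ.identDistrib (hF.sub hGm) i)).trans_le hR
      _ = ENNReal.ofReal (η / 2 * N) := by
          rw [Finset.sum_const, Finset.card_range, nsmul_eq_mul, mul_comm,
            ENNReal.ofReal_mul (by positivity), ENNReal.ofReal_natCast]
  refine (add_le_add h1 (hN₀ N (by omega))).trans_eq ?_
  rw [← ENNReal.ofReal_add (by positivity) (by positivity)]
  congr 1
  ring

end LawOfLargeNumbers

/-! ### Weakly null sequences of odd functions of uniform variables -/

section WeaklyNull

variable {ψ : LorentzWeight}

lemma isIID_of_ae_eq {ξ : ℕ → I → I} (hξ : IsUniformSeq ξ) {F : I → ℝ} (hF : Measurable F)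
    {x : ℕ → I →ₘ[volume] ℝ} (hx : ∀ n, x n =ᵐ[volume] fun ω => F (ξ n ω)) : IsIID x := by
  have hX := hξ.isIIDSeq hF
  refine ⟨hX.indep.congr fun n => (hx n).symm, fun n => ?_⟩
  exact (IdentDistrib.of_ae_eq (x n).aemeasurable (hx n)).trans ((hX.ident n).trans
    (IdentDistrib.of_ae_eq (x 0).aemeasurable (hx 0)).symm)

lemma norm_sum_eq_of_ae_eq {y : ℕ → Lorentz ψ} {Y : ℕ → I → ℝ}
    (hy : ∀ n, (y n : I →ₘ[volume] ℝ) =ᵐ[volume] Y n) (N : ℕ) :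
    ‖∑ k ∈ Finset.range N, y k‖ = (lorentzENorm ψ (∑ k ∈ Finset.range N, Y k)).toReal := by
  rw [norm_sum_eq]
  congr 1
  refine lorentzENorm_congr ψ ?_
  filter_upwards [ae_all_iff.2 hy] with ω hω
  simp only [Finset.sum_apply, hω]

/-- If `g (x n) ≥ ε` infinitely often, the averages along those indices also satisfy this; but they
are averages of independent copies again, hence arbitrarily small in norm for some `N`. This avoids
describing the dual. -/
lemma isWeaklyNull_of_ae_eq {ξ : ℕ → I → I} (hξ : IsUniformSeq ξ) {F : I → ℝ} (hF : Measurable F)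
    (hodd : ∀ t, F (σ t) = -F t) (hfin : lorentzENorm ψ F < ∞) {x : ℕ → Lorentz ψ}
    (hx : ∀ n, (x n : I →ₘ[volume] ℝ) =ᵐ[volume] fun ω => F (ξ n ω)) : IsWeaklyNull x := by
  have key : ∀ (g : StrongDual ℝ (Lorentz ψ)) (ε : ℝ), 0 < ε → ∀ᶠ n in atTop, g (x n) < ε := by
    intro g ε hε
    by_contra hc
    obtain ⟨n, hn, hgn⟩ := extraction_of_frequently_atTop (not_eventually.1 hc)
    obtain ⟨N, hN, hle⟩ := exists_lorentzENorm_sum_le ψ (hξ.precomp hn) hF hodd hfin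
      (η := ε / (‖g‖ + 1)) (by positivity)
    have hN0 : (0 : ℝ) < N := by exact_mod_cast hN
    have h1 : ‖∑ k ∈ Finset.range N, x (n k)‖ ≤ ε / (‖g‖ + 1) * N := by
      rw [norm_sum_eq_of_ae_eq fun k => hx (n k)]
      exact ENNReal.toReal_le_of_le_ofReal (by positivity) hle
    have h2 : N * ε ≤ g (∑ k ∈ Finset.range N, x (n k)) := by
      rw [map_sum]
      calc N * ε = ∑ k ∈ Finset.range N, ε := by simp
        _ ≤ _ := Finset.sum_le_sum fun k _ => not_lt.1 (hgn k)
    have h3 := h2.trans ((le_abs_self _).trans (g.le_opNorm _))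
    have h4 : ‖g‖ * ‖∑ k ∈ Finset.range N, x (n k)‖ ≤ ‖g‖ * (ε / (‖g‖ + 1) * N) := by gcongr
    have h5 : ‖g‖ * (ε / (‖g‖ + 1) * N) < N * ε := by
      have h6 : ‖g‖ / (‖g‖ + 1) < 1 := (div_lt_one (by positivity)).2 (by linarith)
      calc ‖g‖ * (ε / (‖g‖ + 1) * N) = ‖g‖ / (‖g‖ + 1) * (N * ε) := by ring
        _ < 1 * (N * ε) := by gcongr
        _ = N * ε := one_mul _
    linarith
  intro g
  rw [Metric.tendsto_nhds]
  intro ε hε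
  filter_upwards [key g ε hε, key (-g) ε hε] with n h1 h2
  rw [Real.dist_eq, sub_zero, abs_lt]
  rw [neg_apply] at h2
  constructor <;> linarith

end WeaklyNull

/-! ### Necessity -/

section Necessity

/-- The decreasing step function `∑ c j • 𝟙 (0, u j)`. -/
noncomputable def stepSum (u c : ℕ → ℝ) (t : ℝ) : ℝ≥0∞ :=
  ∑' j, (Ioo 0 (u j)).indicator (fun _ => ENNReal.ofReal (c j)) t

/-- The odd function on `[0,1]` which is `∑ c j • 𝟙 (0, u j)` on the left half, if `u j ≤ 1 / 2`. -/
noncomputable def oddStep (u c : ℕ → ℝ) (t : I) : ℝ :=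
  (stepSum u c t).toReal - (stepSum u c (σ t : I)).toReal

variable {ψ : LorentzWeight} {u c : ℕ → ℝ}

lemma measurable_stepSum : Measurable (stepSum u c) :=
  Measurable.tsum fun _ => measurable_const.indicator measurableSet_Ioo

lemma measurable_stepSum_coe : Measurable fun t : I => (stepSum u c t).toReal :=
  (measurable_stepSum.comp measurable_subtype_coe).ennreal_toReal

lemma measurable_oddStep : Measurable (oddStep u c) :=
  measurable_stepSum_coe.sub (measurable_stepSum_coe.comp unitInterval.measurable_symm)

lemma oddStep_symm (t : I) : oddStep u c (σ t) = -oddStep u c t := by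
  rw [oddStep, oddStep, unitInterval.symm_symm]
  ring

lemma stepSum_of_nonpos {t : ℝ} (ht : t ≤ 0) : stepSum u c t = 0 :=
  ENNReal.tsum_eq_zero.2 fun _ => indicator_of_notMem (fun h => absurd h.1 (not_lt.2 ht)) _

lemma stepSum_of_forall_le {t : ℝ} (ht : ∀ j, u j ≤ t) : stepSum u c t = 0 :=
  ENNReal.tsum_eq_zero.2 fun j => indicator_of_notMem (fun h => absurd h.2 (not_lt.2 (ht j))) _

lemma stepSum_antitone {s t : ℝ} (hs : 0 < s) (hst : s ≤ t) : stepSum u c t ≤ stepSum u c s := by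
  refine ENNReal.tsum_le_tsum fun j => ?_
  by_cases ht : t ∈ Ioo 0 (u j)
  · rw [indicator_of_mem ht, indicator_of_mem (show s ∈ Ioo 0 (u j) from ⟨hs, hst.trans_lt ht.2⟩)]
  · rw [indicator_of_notMem ht]
    exact zero_le

/-- At each `t > 0` only finitely many steps are active because `u j → 0`; at `0` the open intervals
exclude all of them. -/
lemma stepSum_ne_top (hu : ∀ j, u j ≤ 1 / ((j : ℝ) + 1)) (t : ℝ) : stepSum u c t ≠ ∞ := by
  rcases le_or_gt t 0 with ht | ht
  · simp [stepSum_of_nonpos ht]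
  obtain ⟨J, hJ⟩ := exists_nat_one_div_lt ht
  rw [stepSum, tsum_eq_sum (s := Finset.range J) fun j hj => ?_]
  · refine ENNReal.sum_ne_top.2 fun j _ => ?_
    by_cases h : t ∈ Ioo 0 (u j)
    · rw [indicator_of_mem h]
      exact ENNReal.ofReal_ne_top
    · simp [indicator_of_notMem h]
  · refine indicator_of_notMem (fun h => ?_) _
    have h1 : (J : ℝ) ≤ j := by exact_mod_cast not_lt.1 fun h => hj (Finset.mem_range.2 h)
    have h2 : 1 / ((j : ℝ) + 1) ≤ 1 / ((J : ℝ) + 1) := by gcongr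
    have := h.2
    linarith [hu j]

lemma le_oddStep (hu : ∀ j, u j ≤ 1 / ((j : ℝ) + 1)) (hu2 : ∀ j, u j ≤ 1 / 2)
    {j : ℕ} {t : I} (ht : (t : ℝ) ∈ Ioo 0 (u j)) : c j ≤ oddStep u c t := by
  -- All steps live on the left half, so the reflected summand vanishes here and nothing cancels.
  have h1 : stepSum u c (σ t : I) = 0 := by
    refine stepSum_of_forall_le fun i => ?_
    rw [unitInterval.coe_symm_eq]
    linarith [hu2 i, hu2 j, ht.2]
  rw [oddStep, h1, ENNReal.toReal_zero, sub_zero]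
  refine (ENNReal.ofReal_le_iff_le_toReal (stepSum_ne_top hu _)).1 ?_
  refine le_trans ?_ (ENNReal.le_tsum j)
  rw [indicator_of_mem ht]

lemma lorentzENorm_stepSum_le (hu : ∀ j, u j ≤ 1 / ((j : ℝ) + 1)) (hu0 : ∀ j, 0 ≤ u j)
    (hc : ∀ j, 0 ≤ c j) :
    lorentzENorm ψ (fun t : I => (stepSum u c t).toReal) ≤ ∑' j, ENNReal.ofReal (c j * ψ (u j)) := by
  have hu1 : ∀ j, u j ≤ 1 := fun j => (hu j).trans (by
    rw [div_le_one (by positivity)]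
    linarith [(j.cast_nonneg : (0 : ℝ) ≤ j)])
  -- A decreasing function dominates its own rearrangement, so the norm of the infinite sum reduces
  -- to exchanging sum and integral.
  have h1 : ∀ t ∈ Ioc (0 : ℝ) 1,
      ENNReal.ofReal (rearr (fun t : I => (stepSum u c t).toReal) t) ≤ stepSum u c t := by
    intro t ht
    refine ENNReal.ofReal_le_of_le_toReal (csInf_le ⟨0, fun _ h => h.1⟩ ⟨ENNReal.toReal_nonneg, ?_⟩)
    have hsub : {s : I | (stepSum u c t).toReal < |(stepSum u c s).toReal|} ⊆
        Iio (⟨t, ht.1.le, ht.2⟩ : I) := by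
      intro s hs
      by_contra hst
      rw [mem_Iio, not_lt] at hst
      have h2 : stepSum u c s ≤ stepSum u c t := stepSum_antitone ht.1 hst
      have h3 := ENNReal.toReal_mono (stepSum_ne_top hu t) h2
      have h4 : (stepSum u c t).toReal < |(stepSum u c s).toReal| := hs
      rw [abs_of_nonneg ENNReal.toReal_nonneg] at h4
      linarith
    refine (measureReal_mono hsub).trans_eq ?_
    rw [measureReal_def, unitInterval.volume_Iio, ENNReal.toReal_ofReal ht.1.le]
  rw [lorentzENorm]
  calc ∫⁻ t in Ioc 0 1, ENNReal.ofReal (rearr (fun t : I => (stepSum u c t).toReal) t)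
        ∂ψ.stieltjes.measure
      ≤ ∫⁻ t in Ioc 0 1, stepSum u c t ∂ψ.stieltjes.measure := setLIntegral_mono' measurableSet_Ioc h1
    _ ≤ ∫⁻ t, stepSum u c t ∂ψ.stieltjes.measure := setLIntegral_le_lintegral _ _
    _ = ∑' j, ∫⁻ t, (Ioo 0 (u j)).indicator (fun _ => ENNReal.ofReal (c j)) t
          ∂ψ.stieltjes.measure :=
        lintegral_tsum fun _ => (measurable_const.indicator measurableSet_Ioo).aemeasurable
    _ = ∑' j, ENNReal.ofReal (c j * ψ (u j)) := by
        refine tsum_congr fun j => ?_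
        rw [lintegral_indicator measurableSet_Ioo, lintegral_const, Measure.restrict_apply_univ,
          StieltjesFunction.measure_Ioo, leftLim_stieltjes, stieltjes_eq ψ (hu0 j) (hu1 j),
          stieltjes_eq ψ le_rfl zero_le_one, ψ.map_zero, sub_zero, ENNReal.ofReal_mul (hc j)]

lemma lorentzENorm_oddStep_le :
    lorentzENorm ψ (oddStep u c) ≤ 2 * lorentzENorm ψ (fun t : I => (stepSum u c t).toReal) := by
  have hm : Measurable fun t : I => (stepSum u c t).toReal := measurable_stepSum_coe
  have hid : IdentDistrib (fun t : I => (stepSum u c (σ t : I)).toReal)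
      (fun t : I => (stepSum u c t).toReal) volume volume :=
    ⟨(hm.comp unitInterval.measurable_symm).aemeasurable, hm.aemeasurable, by
      conv_rhs => rw [← unitInterval.measurePreserving_symm.map_eq,
        Measure.map_map hm unitInterval.measurable_symm]
      rfl⟩
  refine (lorentzENorm_sub_le ψ hm.aemeasurable hid.aemeasurable_fst).trans ?_
  rw [lorentzENorm_eq_of_identDistrib ψ hid, two_mul]

lemma volume_real_coe_mem_Ioo {a : ℝ} (h0 : 0 ≤ a) (h1 : a ≤ 1) :
    volume.real {t : I | (t : ℝ) ∈ Ioo 0 a} = a := by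
  have h : {t : I | (t : ℝ) ∈ Ioo 0 a} = Ioo (0 : I) ⟨a, h0, h1⟩ := rfl
  rw [h, measureReal_def, unitInterval.volume_Ioo]
  simp [h0]

/-- If one of the limit conditions fails, there is a weakly null sequence of independent identically
distributed functions with almost linearly growing sums. -/
lemma exists_isWeaklyNull_isIID_large
    (h : ¬ ((∃ k : ℕ, 2 ≤ k ∧ limsup (fun u : ℝ => ψ (k * u) / ψ u) (𝓝[>] 0) < k) ∧
      (∃ l : ℕ, 2 ≤ l ∧ limsup (fun u : ℝ => ψ (u ^ l) / ψ u) (𝓝[>] 0) < 1))) :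
    ∃ x : ℕ → Lorentz ψ, IsWeaklyNull x ∧ IsIID (fun n => (x n : I →ₘ[volume] ℝ)) ∧
      ∀ n : ℕ → ℕ, StrictMono n → ∀ j : ℕ,
        (2 : ℝ) ^ ((j + 1) ^ 2) * (1 / 2) ^ j / 8 ≤
          ‖∑ k ∈ Finset.range (2 ^ ((j + 1) ^ 2)), x (n k)‖ := by
  -- `2^((j+1)^2)` outgrows every power of the loss `2^j`.
  have hex : ∀ j : ℕ, ∃ v ∈ Ioo (0 : ℝ) (min (1 / 2) (1 / ((j : ℝ) + 1))),
      IsExtremal ψ (2 ^ ((j + 1) ^ 2)) v := fun j =>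
    exists_isExtremal ψ h (Nat.le_self_pow (by positivity) 2) (lt_min (by norm_num) (by positivity))
  choose u hu hext using hex
  have hu0 : ∀ j, 0 < u j := fun j => (hu j).1
  have hu2 : ∀ j, u j ≤ 1 / 2 := fun j => (hu j).2.le.trans (min_le_left _ _)
  have huj : ∀ j, u j ≤ 1 / ((j : ℝ) + 1) := fun j => (hu j).2.le.trans (min_le_right _ _)
  have hu1 : ∀ j, u j ≤ 1 := fun j => (hu2 j).trans (by norm_num)
  have hψu : ∀ j, 0 < ψ (u j) := fun j => ψ.pos (hu0 j) (hu1 j)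
  -- Normalised so that the `j`-th step has norm `2^(-j)`, which makes the series summable.
  set c : ℕ → ℝ := fun j => (1 / 2) ^ j / ψ (u j) with hc
  have hc0 : ∀ j, 0 ≤ c j := fun j => div_nonneg (by positivity) (hψu j).le
  have hcψ : ∀ j, c j * ψ (u j) = (1 / 2) ^ j := fun j => div_mul_cancel₀ _ (hψu j).ne'
  set F := oddStep u c with hF
  have hFm : Measurable F := measurable_oddStep
  have hfin : lorentzENorm ψ F < ∞ := by
    refine lorentzENorm_oddStep_le.trans_lt (ENNReal.mul_lt_top (by simp) ?_)
    refine (lorentzENorm_stepSum_le huj (fun j => (hu0 j).le) hc0).trans_lt ?_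
    simp_rw [hcψ]
    rw [← ENNReal.ofReal_tsum_of_nonneg (fun j => by positivity) summable_geometric_two]
    exact ENNReal.ofReal_lt_top
  obtain ⟨ξ, hξ⟩ := exists_isUniformSeq
  have hXm : ∀ n, AEStronglyMeasurable (fun ω => F (ξ n ω)) volume := fun n =>
    (hFm.comp (hξ.measurable n)).aestronglyMeasurable
  set x : ℕ → Lorentz ψ := fun n => ⟨AEEqFun.mk _ (hXm n), by
    change lorentzENorm ψ _ < ∞
    rw [lorentzENorm_congr ψ (AEEqFun.coeFn_mk _ (hXm n)),
      lorentzENorm_eq_of_identDistrib ψ (hξ.identDistrib hFm n)]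
    exact hfin⟩
  have hx : ∀ n, (x n : I →ₘ[volume] ℝ) =ᵐ[volume] fun ω => F (ξ n ω) := fun n =>
    AEEqFun.coeFn_mk _ (hXm n)
  refine ⟨x, isWeaklyNull_of_ae_eq hξ hFm oddStep_symm hfin hx, isIID_of_ae_eq hξ hFm hx,
    fun n hn j => ?_⟩
  have hA : MeasurableSet {t : I | (t : ℝ) ∈ Ioo 0 (u j)} :=
    measurable_subtype_coe measurableSet_Ioo
  have hvol := volume_real_coe_mem_Ioo (hu0 j).le (hu1 j)
  have hlow := le_lorentzENorm_sum_of_isExtremal ψ (hξ.precomp hn) hFm oddStep_symm hA (hc0 j)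
    (fun t ht => le_oddStep huj hu2 ht) (N := 2 ^ ((j + 1) ^ 2)) (by rw [hvol]; exact hext j)
  rw [hvol, mul_assoc, hcψ] at hlow
  push_cast at hlow
  rw [norm_sum_eq_of_ae_eq fun k => hx (n k)]
  -- Finiteness is needed because `toReal` sends `∞` to `0`.
  refine (ENNReal.ofReal_le_iff_le_toReal (ne_of_lt ?_)).1 hlow
  refine (lorentzENorm_sum_le ψ _ _ fun k _ =>
    (hFm.comp (hξ.measurable (n k))).aemeasurable).trans_lt ?_
  refine ENNReal.sum_lt_top.2 fun k _ => ?_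
  exact (lorentzENorm_eq_of_identDistrib ψ (hξ.identDistrib hFm (n k))).trans_lt hfin

lemma le_one_of_mem_gammaIid
    (h : ¬ ((∃ k : ℕ, 2 ≤ k ∧ limsup (fun u : ℝ => ψ (k * u) / ψ u) (𝓝[>] 0) < k) ∧
      (∃ l : ℕ, 2 ≤ l ∧ limsup (fun u : ℝ => ψ (u ^ l) / ψ u) (𝓝[>] 0) < 1)))
    {p : ℝ} (hp : p ∈ gammaIid ψ) : p ≤ 1 := by
  by_contra! hp1
  obtain ⟨x, hw, hiid, hlarge⟩ := exists_isWeaklyNull_isIID_large h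
  obtain ⟨n, hn, -, hBS⟩ := hp.2 x hw hiid
  obtain ⟨C, hC⟩ := hBS id strictMono_id
  set a := 1 - 1 / p with ha
  have ha0 : 0 < a := by
    have := (div_lt_one (by linarith : 0 < p)).2 hp1
    linarith
  -- `(j+1) a ≥ 2` gives `(j+1)² a - j ≥ j`, so the normalised norm is at least `2^j / 8 > j / 8 >
  -- C`.
  obtain ⟨j₁, hj₁⟩ := exists_nat_ge (2 / a)
  obtain ⟨j₂, hj₂⟩ := exists_nat_gt (8 * C)
  set j := max j₁ j₂ with hj
  have h1 : 2 ≤ ((j : ℝ) + 1) * a := by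
    have : (j₁ : ℝ) ≤ j := by exact_mod_cast le_max_left _ _
    rw [div_le_iff₀ ha0] at hj₁
    nlinarith
  have h2 : 8 * C < j := hj₂.trans_le (by exact_mod_cast le_max_right _ _)
  set L : ℕ := (j + 1) ^ 2 with hL
  have h3 := hC (2 ^ L) Nat.one_le_two_pow
  have h4 := hlarge n hn j
  have h5 : (0 : ℝ) < (2 : ℝ) ^ L := by positivity
  have h6 : ((2 : ℝ) ^ L) ^ (-(1 / p)) * ((2 : ℝ) ^ L * (1 / 2) ^ j / 8) ≤ C := by
    refine le_trans ?_ h3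
    push_cast
    gcongr
    exact h4
  have h7 : ((2 : ℝ) ^ L) ^ (-(1 / p)) * ((2 : ℝ) ^ L * (1 / 2) ^ j / 8) =
      (2 : ℝ) ^ (L * a - j) / 8 := by
    have h8 : ((2 : ℝ) ^ L) ^ (-(1 / p)) * (2 : ℝ) ^ L = (2 : ℝ) ^ (L * a) := by
      rw [← Real.rpow_add_one h5.ne', ← Real.rpow_natCast, ← Real.rpow_mul (by norm_num), ha]
      ring_nf
    rw [Real.rpow_sub (by norm_num), Real.rpow_natCast, ← h8, one_div_pow]
    ring
  have h9 : (j : ℝ) ≤ L * a - j := by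
    rw [hL]
    push_cast
    nlinarith
  have h10 : (j : ℝ) < (2 : ℝ) ^ (L * a - j) := by
    calc (j : ℝ) < 2 ^ j := by exact_mod_cast Nat.lt_two_pow_self
      _ = (2 : ℝ) ^ (j : ℝ) := (Real.rpow_natCast _ _).symm
      _ ≤ _ := Real.rpow_le_rpow_of_exponent_le (by norm_num) h9
  rw [h7] at h6
  linarith

end Necessity

end LorentzBS

theorem mainTheorem4 (ψ : LorentzBS.LorentzWeight) :
    LorentzBS.gammaIid ψ ≠ {1} ↔
      (∃ k : ℕ, 2 ≤ k ∧ limsup (fun u : ℝ => ψ (k * u) / ψ u) (𝓝[>] 0) < k) ∧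
      (∃ l : ℕ, 2 ≤ l ∧ limsup (fun u : ℝ => ψ (u ^ l) / ψ u) (𝓝[>] 0) < 1) := by
  constructor
  · intro hne
    by_contra hc
    exact hne (Subset.antisymm
      (fun p hp => le_antisymm (LorentzBS.le_one_of_mem_gammaIid hc hp) hp.1)
      (singleton_subset_iff.2 LorentzBS.one_mem_gammaIid))
  · rintro ⟨hk, hl⟩ heq
    obtain ⟨p, hp, hp1⟩ := LorentzBS.exists_one_lt_mem_gammaIid hk hl
    rw [heq] at hp
    exact hp1.ne' hp
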